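/- Let $\mathbf a=(a_i)_{i\ge 0}$ be a sequence of non-negative integers such that (A1) $\mathbf a$ is bounded, with $N=\max_i a_i$; (A2) $a_0\neq 0$; (A3) there is an integer $C>0$ such that $a_i=a_{i+1}=\dots=a_{i+k}=0$ implies $k<C$. **The alphabet.** In the full shift $\mathcal S=\{*,0,1,\dots,N\}^{\mathbb Z}$ (product topology, left shift $\sigma(x)_n=x_{n+1}$) let $[0]$ be the point with $[0]_m=a_m$ for $m\ge 0$ and $[0]_m=*$ for $m<0$, let $[i]=\sigma^i([0])$ for $i\geq 0$, and let $\mathcal A$ be the closure of $\{[i]: i\ge 0\}$ in $\mathcal S$, a compact space. The points $\mathbf b\in\mathcal A$ that are not of the form $[i]$ have no entry $*$, and $\sigma^{\pm1}(\mathbf b)\in\mathcal A$. **The substitution.** Let $\mathcal A^+$ be the space of non-empty finite words over $\mathcal A$ (disjoint union of the products $\mathcal A^n$, $n\ge 1$). Let $\varrho_{\mathbf a}:\mathcal A\to\mathcal A^+$ be the continuous map with $$\varrho_{\mathbf a}([0])=[0]^{a_0}\,[1],\qquad \varrho_{\mathbf a}([i])=[0]^{a_i}\,[i-1]\,[i+1]\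 \ (i>0),\qquad \varrho_{\mathbf a}(\mathbf b)=[0]^{b_0}\,\sigma^{-1}(\mathbf b)\,\sigma(\mathbf b)\ \ (\mathbf b\in\mathcal A\setminus\{[i]:i\ge0\}),$$ extended to words by concatenation. The word $\varrho_{\mathbf a}^k(c)$ is the level-$k$ supertile of type $c\in\mathcal A$. The language $\mathcal L$ is the closure, in the space of finite words, of the set of all subwords of supertiles $\varrho_{\mathbf a}^k(c)$, $k\ge 0$, $c\in\mathcal A$, and $X\subset\mathcal A^{\mathbb Z}$ is the set of bi-infinite words all of whose finite subwords are in $\mathcal L$. **The operator.** For $\mathbb K=\mathbb R$ or $\mathbb K=\mathbb C$ let $M$ be the bounded operator $Mf(c)=\sum_{b\in\varrho_{\mathbf a}(c)}f(b)$ (counted with multiplicity) on the Banach space $C(\mathcal A,\mathbb K)$ with the supremum norm, and $r(M)$ its spectral radius (over $\mathbb K$). The real case is the primary one. **Theorem.** The following hold. 1. $\varrho_{\mathbf a}$ is primitive: for every non-empty open $U\subset\mathcal A$ there is $k\ge 1$ such that for every $c\in\mathcal A$ the word $\varrho_{\mathbf a}^k(c)$ contains a letter in $U$. 2. $\varrho_{\mathbf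 a}$ is recognizable: for every $k\ge 1$, every $x\in X$ has exactly one decomposition into level-$k$ supertiles, that is, there are a unique $y\in\mathcal A^{\mathbb Z}$ and a unique $c:\mathbb Z\to\mathbb Z$ with $c(0)\le 0<c(1)$ such that for all $i\in\mathbb Z$ one has $c(i+1)=c(i)+|\varrho_{\mathbf a}^k(y_i)|$ and $x_{c(i)}x_{c(i)+1}\cdots x_{c(i+1)-1}=\varrho_{\mathbf a}^k(y_i)$; moreover $y\in X$. 3. The normalized substitution operator $T=M/r(M)$ is quasicompact: $r(T)=1$, and there are $k\ge 1$ and a compact operator $K$ with $\|T^k-K\|<1$. 4. For every $C$ as in (A3), $F=\{[0],[1],\dots,[C+1]\}$ is a finite set of isolated points of $\mathcal A$, and for every $c\in\mathcal A$ the number of letters (with multiplicity) of $\varrho_{\mathbf a}^{C+2}(c)$ that are not in $F$ is strictly less than $r(M)^{C+2}$. -/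

import Mathlib

open Topology

noncomputable section

namespace CompactSubstitution

/-! ## Substitutions on a topological alphabet -/

/-- A substitution: a continuous map `A → A⁺`. Words are lists; Mathlib's topology on `List A` is
the disjoint union of the product topologies on the sets `Aⁿ`, and `A⁺` (the non-empty words)
carries the subspace topology. -/
structure Substitution (A : Type*) [TopologicalSpace A] where
  /-- the image word of a letter -/
  toFun : A → List A
  ne_nil : ∀ b, toFun b ≠ []
  continuous_toFun : Continuous toFun

section General

variable {A : Type*} [TopologicalSpace A]

/-- The level-`k` supertile `ϱᵏ(b)` of type `b`, where `ϱ` acts on words by concatenation. -/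
def Substitution.supertile (ρ : Substitution A) (k : ℕ) (b : A) : List A :=
  (fun w : List A => w.flatMap ρ.toFun)^[k] [b]

/-- Every non-empty open set is met by the supertiles `ϱᵏ(b)` of all types `b`, for one `k`. -/
def Substitution.IsPrimitive (ρ : Substitution A) : Prop :=
  ∀ U : Set A, IsOpen U → U.Nonempty → ∃ k : ℕ, 1 ≤ k ∧ ∀ b : A, ∃ c ∈ ρ.supertile k b, c ∈ U

/-- The language of `ϱ`: the closure, in the space of finite words, of the set of all subwords of
supertiles. -/
def Substitution.language (ρ : Substitution A) : Set (List A) :=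
  closure {u : List A | ∃ (k : ℕ) (b : A), u <:+: ρ.supertile k b}

/-- The subshift of `ϱ`: the bi-infinite words all of whose finite subwords
`x i, x (i+1), …, x (i+n-1)` belong to the language. -/
def Substitution.subshift (ρ : Substitution A) : Set (ℤ → A) :=
  {x | ∀ (i : ℤ) (n : ℕ), List.ofFn (fun j : Fin n => x (i + (j : ℕ))) ∈ ρ.language}

/-- `(y, c)` is a decomposition of the bi-infinite word `x` into level-`k` supertiles: `x` is cut
at the positions `c i`, and the block between the cuts `c i` and `c (i+1)` is the supertile
`ϱᵏ(y i)`. The enumeration of the blocks is normalised: block number `0` covers position `0`. -/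
def Substitution.IsDecomposition (ρ : Substitution A) (k : ℕ) (x : ℤ → A)
    (y : ℤ → A) (c : ℤ → ℤ) : Prop :=
  c 0 ≤ 0 ∧ 0 < c 1 ∧
    ∀ i : ℤ, c (i + 1) = c i + ((ρ.supertile k (y i)).length : ℤ) ∧
      ∀ (j : ℕ) (hj : j < (ρ.supertile k (y i)).length),
        x (c i + j) = (ρ.supertile k (y i))[j]

/-- For every `k ≥ 1`, every element of the subshift has a decomposition into level-`k`
supertiles; the types of the supertiles form an element of the subshift again; and this is the only
decomposition, among those with supertile types from an arbitrary bi-infinite word. -/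
def Substitution.IsRecognizable (ρ : Substitution A) : Prop :=
  ∀ k : ℕ, 1 ≤ k → ∀ x ∈ ρ.subshift,
    ∃ (y : ℤ → A) (c : ℤ → ℤ), y ∈ ρ.subshift ∧ ρ.IsDecomposition k x y c ∧
      ∀ (y' : ℤ → A) (c' : ℤ → ℤ), ρ.IsDecomposition k x y' c' → y' = y ∧ c' = c

theorem continuous_list_map_sum {𝕜 : Type*} [RCLike 𝕜] (f : C(A, 𝕜)) :
    Continuous (fun l : List A => (l.map f).sum) := by
  have h : Continuous (fun l : List A => l.map f) := by
    rw [continuous_iff_continuousAt]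
    refine List.tendsto_nhds (r := fun l => 𝓝 (l.map f)) ?_ ?_
    · simp
    · intro l b ih
      exact ((f.continuous.tendsto b).comp Filter.tendsto_fst).cons (ih.comp Filter.tendsto_snd)
  exact List.continuous_sum.comp h

theorem Substitution.exists_length_le [CompactSpace A] (ρ : Substitution A) :
    ∃ B : ℕ, ∀ b, (ρ.toFun b).length ≤ B := by
  have h : Continuous (fun b => (ρ.toFun b).length) :=
    (continuous_iff_continuousAt.2 List.continuousAt_length).comp ρ.continuous_toFun
  obtain ⟨B, hB⟩ := (isCompact_range h).bddAbove
  exact ⟨B, fun b => hB ⟨b, rfl⟩⟩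

/-- The substitution operator `(M f)(b) = ∑_{c ∈ ϱ(b)} f c` (with multiplicities) on the Banach
space `C(A, 𝕜)` with the supremum norm. -/
def Substitution.operator (𝕜 : Type*) [RCLike 𝕜] [CompactSpace A] (ρ : Substitution A) :
    C(A, 𝕜) →L[𝕜] C(A, 𝕜) :=
  LinearMap.mkContinuousOfExistsBound
    { toFun := fun f =>
        { toFun := fun b => ((ρ.toFun b).map f).sum
          continuous_toFun := (continuous_list_map_sum f).comp ρ.continuous_toFun }
      map_add' := fun f g => by
        ext b
        exact List.sum_map_add
      map_smul' := fun r f => by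
        ext b
        exact List.sum_map_mul_left (ρ.toFun b) (fun c => f c) r }
    (by
      obtain ⟨B, hB⟩ := ρ.exists_length_le
      refine ⟨B, fun f => (ContinuousMap.norm_le _ (by positivity)).2 fun b => ?_⟩
      have key : ∀ l : List A, ‖(l.map f).sum‖ ≤ l.length * ‖f‖ := by
        intro l
        induction l with
        | nil => simp
        | cons c l ih =>
          have h1 := norm_add_le (f c) (l.map f).sum
          have h2 := f.norm_coe_le_norm c
          simp only [List.map_cons, List.sum_cons, List.length_cons]
          push_cast
          linarith
      refine (key _).trans ?_
      have : ((ρ.toFun b).length : ℝ) ≤ B := by exact_mod_cast hB b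
      gcongr)

/-- The spectral radius `r(M)` of the substitution operator, as a real number. -/
def Substitution.specRadius (𝕜 : Type*) [RCLike 𝕜] [CompactSpace A] (ρ : Substitution A) : ℝ :=
  (spectralRadius 𝕜 (ρ.operator 𝕜)).toReal

/-- The normalized substitution operator `M / r(M)`. -/
def Substitution.normalizedOperator (𝕜 : Type*) [RCLike 𝕜] [CompactSpace A]
    (ρ : Substitution A) : C(A, 𝕜) →L[𝕜] C(A, 𝕜) :=
  ((ρ.specRadius 𝕜 : 𝕜)⁻¹) • ρ.operator 𝕜

open Classical in
/-- The number of letters of a word (with multiplicity) that do not lie in `F`. -/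
def countOutside (F : Set A) (w : List A) : ℕ := w.countP (fun c => c ∉ F)

end General

/-- A bounded operator `T` with `r(T) = 1` is quasicompact if `‖Tᵏ - K‖ < 1` for some `k ≥ 1` and
some compact operator `K`. The requirement `r(T) = 1` is part of the predicate. -/
def IsQuasicompact {𝕜 E : Type*} [RCLike 𝕜] [NormedAddCommGroup E] [NormedSpace 𝕜 E]
    (T : E →L[𝕜] E) : Prop :=
  spectralRadius 𝕜 T = 1 ∧
    ∃ (k : ℕ) (K : E →L[𝕜] E), 1 ≤ k ∧ IsCompactOperator K ∧ ‖T ^ k - K‖ < 1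

/-! ## The compact alphabet of a bounded sequence -/

/-- The finite set of symbols `{*, 0, 1, …, N}` (`none` is the symbol `*`), a discrete space. -/
def Sym (N : ℕ) : Type := Option (Fin (N + 1))

instance (N : ℕ) : TopologicalSpace (Sym N) := ⊥

instance (N : ℕ) : DiscreteTopology (Sym N) := ⟨rfl⟩

instance (N : ℕ) : Finite (Sym N) := inferInstanceAs (Finite (Option (Fin (N + 1))))

/-- The symbol `*`. -/
def asterisk {N : ℕ} : Sym N := (none : Option (Fin (N + 1)))

/-- The symbol given by a number in `{0, …, N}`. -/
def num {N : ℕ} (n : Fin (N + 1)) : Sym N := (some n : Option (Fin (N + 1)))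

/-- The number that a symbol stands for (and `0` for the symbol `*`). -/
def Sym.val {N : ℕ} (s : Sym N) : ℕ :=
  Option.elim (show Option (Fin (N + 1)) from s) 0 (fun n => (n : ℕ))

/-- The left shift `σ`. -/
def shift {B : Type*} (x : ℤ → B) : ℤ → B := fun m => x (m + 1)

/-- The inverse `σ⁻¹` of the left shift. -/
def unshift {B : Type*} (x : ℤ → B) : ℤ → B := fun m => x (m - 1)

/-- A sequence of non-negative integers with values at most `N`, as a sequence in `{0, …, N}`. -/
def digits (a : ℕ → ℕ) (N : ℕ) (h : IsGreatest (Set.range a) N) : ℕ → Fin (N + 1) :=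
  fun i => ⟨a i, Nat.lt_succ_of_le (h.2 ⟨i, rfl⟩)⟩

section Alphabet

variable {N : ℕ} (a : ℕ → Fin (N + 1))

/-- The point `… * * * a₀ a₁ a₂ …` of the full shift, with `a₀` at the origin. -/
def zeroPoint : ℤ → Sym N := fun m => if 0 ≤ m then num (a m.toNat) else asterisk

/-- The embedding of the non-negative integers into the full shift: `i ↦ σⁱ(… * * * a₀ a₁ a₂ …)`. -/
def embed (i : ℕ) : ℤ → Sym N := shift^[i] (zeroPoint a)

/-- The compact alphabet: the closure of the image of the embedding in the full shift
`{*, 0, …, N}^ℤ` with the product topology. -/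
abbrev Alphabet : Type := {b : ℤ → Sym N // b ∈ closure (Set.range (embed a))}

instance : CompactSpace (Alphabet a) := isCompact_iff_compactSpace.1 isClosed_closure.isCompact

/-- The letter `[i]`. -/
def letter (i : ℕ) : Alphabet a := ⟨embed a i, subset_closure ⟨i, rfl⟩⟩

theorem embed_apply (i : ℕ) (m : ℤ) : embed a i m = zeroPoint a (m + i) := by
  unfold embed
  induction i generalizing m with
  | zero => simp
  | succ i ih =>
    rw [Function.iterate_succ_apply']
    show (shift^[i] (zeroPoint a)) (m + 1) = _
    rw [ih]
    congr 1
    push_cast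
    ring

theorem shift_embed (i : ℕ) : shift (embed a i) = embed a (i + 1) :=
  (Function.iterate_succ_apply' shift i (zeroPoint a)).symm

theorem unshift_embed (i : ℕ) : unshift (embed a (i + 1)) = embed a i := by
  rw [← shift_embed]
  funext m
  simp [shift, unshift]

theorem continuous_shift {B : Type*} [TopologicalSpace B] :
    Continuous (shift : (ℤ → B) → (ℤ → B)) :=
  continuous_pi fun m => continuous_apply (m + 1)

theorem continuous_unshift {B : Type*} [TopologicalSpace B] :
    Continuous (unshift : (ℤ → B) → (ℤ → B)) :=
  continuous_pi fun m => continuous_apply (m - 1)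

theorem shift_mem (b : Alphabet a) : shift b.1 ∈ closure (Set.range (embed a)) := by
  refine map_mem_closure continuous_shift b.2 ?_
  rintro _ ⟨i, rfl⟩
  exact ⟨i + 1, (shift_embed a i).symm⟩

theorem num_ne_star (n : Fin (N + 1)) : num n ≠ asterisk := Option.some_ne_none n

theorem embed_zero_neg_one : embed a 0 (-1) = asterisk := by simp [embed_apply, zeroPoint]

theorem embed_succ_neg_one (i : ℕ) : embed a (i + 1) (-1) ≠ asterisk := by
  rw [embed_apply, zeroPoint, if_pos (by push_cast; omega)]
  exact num_ne_star _

theorem embed_apply_zero (i : ℕ) : embed a i 0 = num (a i) := by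
  simp [embed_apply, zeroPoint]

theorem unshift_mem (b : Alphabet a) (hb : b.1 (-1) ≠ asterisk) :
    unshift b.1 ∈ closure (Set.range (embed a)) := by
  have hU : IsOpen {x : ℤ → Sym N | x (-1) ≠ asterisk} :=
    (isOpen_discrete {s : Sym N | s ≠ asterisk}).preimage
      (continuous_apply (A := fun _ : ℤ => Sym N) (-1 : ℤ))
  have h := hU.inter_closure ⟨hb, b.2⟩
  refine map_mem_closure continuous_unshift h ?_
  rintro _ ⟨hx, ⟨i, rfl⟩⟩
  cases i with
  | zero => exact absurd (embed_zero_neg_one a) hx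
  | succ i => exact ⟨i, (unshift_embed a i).symm⟩

/-- The letter `σ(b)`. -/
def next (b : Alphabet a) : Alphabet a := ⟨shift b.1, shift_mem a b⟩

open Classical in
/-- The letter `σ⁻¹(b)` as a one-letter word; the empty word if `b = [0]`, the only letter with a
`*` at position `-1`. -/
def prevWord (b : Alphabet a) : List (Alphabet a) :=
  if h : b.1 (-1) = asterisk then [] else [⟨unshift b.1, unshift_mem a b h⟩]

/-- The word `ϱ(b) = [0]^{b₀} σ⁻¹(b) σ(b)`, in which the middle letter is missing for `b = [0]`.
See `substWord_letter_zero`, `substWord_letter_succ`, `substWord_infinity` for the cases. -/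
def substWord (b : Alphabet a) : List (Alphabet a) :=
  List.replicate (b.1 0).val (letter a 0) ++ (prevWord a b ++ [next a b])

theorem next_letter (i : ℕ) : next a (letter a i) = letter a (i + 1) :=
  Subtype.ext (shift_embed a i)

/-- `ϱ([0]) = [0]^{a₀} [1]`. -/
theorem substWord_letter_zero :
    substWord a (letter a 0) = List.replicate (a 0 : ℕ) (letter a 0) ++ [letter a 1] := by
  have h1 : prevWord a (letter a 0) = [] := dif_pos (embed_zero_neg_one a)
  have h2 : ((letter a 0).1 0).val = (a 0 : ℕ) := by
    show (embed a 0 0).val = _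
    rw [embed_apply_zero]; rfl
  rw [substWord, h1, h2, next_letter]
  rfl

/-- `ϱ([i]) = [0]^{aᵢ} [i-1] [i+1]` for `i > 0`. -/
theorem substWord_letter_succ (i : ℕ) :
    substWord a (letter a (i + 1)) =
      List.replicate (a (i + 1) : ℕ) (letter a 0) ++ [letter a i, letter a (i + 2)] := by
  have h1 : prevWord a (letter a (i + 1)) = [letter a i] := by
    refine (dif_neg (embed_succ_neg_one a i)).trans ?_
    congr 1
    exact Subtype.ext (unshift_embed a i)
  have h2 : ((letter a (i + 1)).1 0).val = (a (i + 1) : ℕ) := by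
    show (embed a (i + 1) 0).val = _
    rw [embed_apply_zero]; rfl
  rw [substWord, h1, h2, next_letter]
  rfl

/-- If `b` is not one of the letters `[i]`, then no entry of `b` is `*`. -/
theorem ne_star_of_infinity (b : Alphabet a) (hb : b.1 ∉ Set.range (embed a)) (m : ℤ) :
    b.1 m ≠ asterisk := by
  intro hm
  have hU : IsOpen {x : ℤ → Sym N | x m = asterisk} :=
    (isOpen_discrete {s : Sym N | s = asterisk}).preimage
      (continuous_apply (A := fun _ : ℤ => Sym N) m)
  have h := hU.inter_closure ⟨hm, b.2⟩
  have hfin : ({x : ℤ → Sym N | x m = asterisk} ∩ Set.range (embed a)).Finite := by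
    refine ((Set.finite_Iio ((-m).toNat)).image (embed a)).subset ?_
    rintro _ ⟨hx, ⟨i, rfl⟩⟩
    refine ⟨i, ?_, rfl⟩
    by_contra hi
    simp only [Set.mem_Iio, not_lt] at hi
    have hx' : embed a i m = asterisk := hx
    rw [embed_apply, zeroPoint, if_pos (by omega)] at hx'
    exact num_ne_star _ hx'
  rw [hfin.isClosed.closure_eq] at h
  exact hb h.2

/-- `ϱ([∞_b]) = [0]^{b₀} [∞_{σ⁻¹(b)}] [∞_{σ(b)}]` for the letters `b` other than the `[i]`;
here `b₀` is a number. -/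
theorem substWord_infinity (b : Alphabet a) (hb : b.1 ∉ Set.range (embed a)) :
    ∃ (n : Fin (N + 1)) (p q : Alphabet a), b.1 0 = num n ∧ p.1 = unshift b.1 ∧ q.1 = shift b.1 ∧
      substWord a b = List.replicate (n : ℕ) (letter a 0) ++ [p, q] := by
  have h1 := ne_star_of_infinity a b hb (-1)
  obtain ⟨n, hn⟩ := Option.ne_none_iff_exists'.1 (ne_star_of_infinity a b hb 0)
  have hn' : b.1 0 = num n := hn
  refine ⟨n, ⟨unshift b.1, unshift_mem a b h1⟩, next a b, hn', rfl, rfl, ?_⟩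
  have h2 : prevWord a b = [⟨unshift b.1, unshift_mem a b h1⟩] := dif_neg h1
  rw [substWord, h2, hn']
  rfl

theorem continuous_substWord : Continuous (substWord a) := by
  have hc : ∀ m : ℤ, Continuous (fun b : Alphabet a => b.1 m) := fun m =>
    (continuous_apply m).comp continuous_subtype_val
  have hnext : Continuous (next a) := (continuous_shift.comp continuous_subtype_val).subtype_mk _
  have hcons : ∀ (f : Alphabet a) (g : Alphabet a → List (Alphabet a)) (b : Alphabet a),
      ContinuousAt g b → ContinuousAt (fun x => f :: g x) b := fun f g b hg =>
    Filter.Tendsto.cons tendsto_const_nhds hg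
  have hprefix : ∀ (n : ℕ) (g : Alphabet a → List (Alphabet a)) (b : Alphabet a),
      ContinuousAt g b → ContinuousAt (fun x => List.replicate n (letter a 0) ++ g x) b := by
    intro n g b hg
    induction n with
    | zero => simpa using hg
    | succ n ih => exact hcons _ _ b ih
  have hlast : Continuous (fun x : Alphabet a => [next a x]) :=
    List.continuous_cons.comp (hnext.prodMk continuous_const)
  rw [continuous_iff_continuousAt]
  intro b
  have hev : ∀ m : ℤ, ∀ᶠ x : Alphabet a in 𝓝 b, x.1 m = b.1 m := fun m =>
    (hc m).continuousAt.eventually (p := fun s => s = b.1 m) (by simp [nhds_discrete])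
  have hmid : ContinuousAt (fun x => prevWord a x ++ [next a x]) b := by
    by_cases h : b.1 (-1) = asterisk
    · refine hlast.continuousAt.congr ?_
      filter_upwards [hev (-1)] with x hx
      have : prevWord a x = [] := dif_pos (hx.trans h)
      rw [this]
      rfl
    · classical
      let p : Alphabet a → Alphabet a := fun x =>
        if hx : x.1 (-1) = asterisk then b else ⟨unshift x.1, unshift_mem a x hx⟩
      have hp : ContinuousAt p b := by
        rw [Topology.IsInducing.subtypeVal.continuousAt_iff]
        refine (continuous_unshift.comp continuous_subtype_val).continuousAt.congr ?_
        filter_upwards [hev (-1)] with x hx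
        have hx' : x.1 (-1) ≠ asterisk := fun e => h (hx.symm.trans e)
        simp [p, hx']
      have hcat : ContinuousAt (fun x => p x :: [next a x]) b :=
        Filter.Tendsto.cons hp hlast.continuousAt
      refine hcat.congr ?_
      filter_upwards [hev (-1)] with x hx
      have hx' : x.1 (-1) ≠ asterisk := fun e => h (hx.symm.trans e)
      simp [p, prevWord, hx']
  refine (hprefix (b.1 0).val _ b hmid).congr ?_
  filter_upwards [hev 0] with x hx
  rw [substWord, hx]

/-- The substitution `ϱ_a` on the compact alphabet. -/
def substitution : Substitution (Alphabet a) where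
  toFun := substWord a
  ne_nil b := by simp [substWord]
  continuous_toFun := continuous_substWord a

end Alphabet

end CompactSubstitution

end

/-! Everything combinatorial rests on the letter `[0]`. As `a 0 ≠ 0` and blocks of zeros are short,
every level-(C+1) supertile contains `[0]` (`letter_zero_mem_supertile`). Its supertiles contain all
`[i]`, which are dense; this is primitivity. Desubstitutions exist by compactness
(`Substitution.exists_isCut_mem_subshift`). For uniqueness, a block is a run of `[0]` followed by at
most two letters, has length at least two and never ends in `[0]`. So a position ends a block iff
its letter is not `[0]` and the next position does not end one (`IsCut.mem_range_iff`). This fixes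
the cuts backwards from every `[0]`, and `[0]` recurs to the right of every position. Higher levels
follow by factoring cuts. For the operator, let λ be the infimum of the `l > 0` with `M u ≤ l u` for
some continuous `u > 0`. If λ were outside the spectrum, the resolvent at λ applied to `1` would
give (after taking real parts) a positive `u` with `M u = λ u - 1`, and λ could be lowered. Hence
`r(M) ≥ λ`, over ℝ as well as over ℂ. At a minimum of `u` one reads off that λᵏ is at least the
shortest level-`k` supertile length. At level C+2 all lengths exceed 2^(C+2): images have at least
two letters, and an image with three is met on the way. But at most 2^(C+2) of the letters lie
outside `F`, since inserted copies of `[0]` have all their descendants in `F`. Subtracting the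
finite-rank part carried by `F` gives quasicompactness. -/

noncomputable section

namespace CompactSubstitution

/-! ## Windows and decompositions -/

section Words

variable {A : Type*}

/-- The word `x i, x (i+1), …, x (i+n-1)`. -/
def window (x : ℤ → A) (i : ℤ) (n : ℕ) : List A := List.ofFn (fun j : Fin n => x (i + (j : ℕ)))

@[simp] theorem length_window (x : ℤ → A) (i : ℤ) (n : ℕ) : (window x i n).length = n := by
  simp [window]

@[simp] theorem window_zero (x : ℤ → A) (i : ℤ) : window x i 0 = [] := by simp [window]

theorem window_succ (x : ℤ → A) (i : ℤ) (n : ℕ) :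
    window x i (n + 1) = x i :: window x (i + 1) n := by
  simp only [window, List.ofFn_succ]
  simp [add_comm, add_left_comm]

theorem window_add (x : ℤ → A) (i : ℤ) (m n : ℕ) :
    window x i (m + n) = window x i m ++ window x (i + m) n := by
  induction m generalizing i with
  | zero => simp
  | succ m ih =>
    rw [show m + 1 + n = (m + n) + 1 by ring, window_succ, window_succ, ih]
    simp [add_comm, add_left_comm]

theorem getElem_window (x : ℤ → A) (i : ℤ) (n j : ℕ) (h : j < (window x i n).length) :
    (window x i n)[j] = x (i + j) := by
  simp [window]

theorem window_eq_iff (x : ℤ → A) (i : ℤ) (w : List A) :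
    window x i w.length = w ↔ ∀ (j : ℕ) (hj : j < w.length), x (i + j) = w[j] := by
  constructor
  · intro h j hj
    rw [← getElem_window x i w.length j (by simpa using hj)]
    simp only [h]
  · intro h
    refine List.ext_getElem (by simp) fun j h1 h2 => ?_
    rw [getElem_window, h]

theorem window_infix_of_window_eq {y : ℤ → A} {w : List A} (h : window y 0 w.length = w)
    (i : ℤ) (n : ℕ) (h0 : 0 ≤ i) (h1 : i + n ≤ w.length) : window y i n <:+: w := by
  obtain ⟨p, rfl⟩ := Int.eq_ofNat_of_zero_le h0
  obtain ⟨r, hr⟩ : ∃ r, w.length = p + n + r := ⟨w.length - p - n, by omega⟩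
  rw [hr, window_add, window_add, zero_add] at h
  rw [← h]
  exact ⟨_, _, rfl⟩

theorem window_translate (x : ℤ → A) (t i : ℤ) (n : ℕ) :
    window (fun j => x (j + t)) i n = window x (i + t) n := by
  refine List.ext_getElem (by simp) fun j h1 h2 => ?_
  rw [getElem_window, getElem_window]
  congr 1
  ring

theorem length_pos_of_forall_ne_nil {τ : A → List A} (hτ : ∀ b, τ b ≠ []) (b : A) : 0 < (τ b).length :=
  List.length_pos_of_ne_nil (hτ b)

theorem length_le_length_flatMap {τ : A → List A} (hτ : ∀ b, τ b ≠ []) (w : List A) :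
    w.length ≤ (w.flatMap τ).length := by
  induction w with
  | nil => simp
  | cons b w ih =>
    have := length_pos_of_forall_ne_nil hτ b
    simp only [List.flatMap_cons, List.length_append, List.length_cons]
    omega

/-- `c` cuts the bi-infinite word `x` into the blocks `τ (y i)`, block number `i` starting at
position `c i`. -/
def IsCut (τ : A → List A) (x y : ℤ → A) (c : ℤ → ℤ) : Prop :=
  ∀ i, c (i + 1) = c i + ((τ (y i)).length : ℤ) ∧ window x (c i) (τ (y i)).length = τ (y i)

variable {τ τ' : A → List A} {x y : ℤ → A} {c : ℤ → ℤ}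

theorem IsCut.lt_succ (h : IsCut τ x y c) (hτ : ∀ b, τ b ≠ []) (i : ℤ) : c i < c (i + 1) := by
  have := (h i).1
  have := length_pos_of_forall_ne_nil hτ (y i)
  omega

theorem IsCut.strictMono (h : IsCut τ x y c) (hτ : ∀ b, τ b ≠ []) : StrictMono c :=
  strictMono_int_of_lt_succ (h.lt_succ hτ)

theorem exists_mem_Ico_of_strictMono {c : ℤ → ℤ} (h : StrictMono c) (s : ℤ) :
    ∃ t, c t ≤ s ∧ s < c (t + 1) := by
  have hup : ∀ n : ℕ, c 0 + n ≤ c n := by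
    intro n
    induction n with
    | zero => simp
    | succ n ih =>
      have := h (show (n : ℤ) < ((n + 1 : ℕ) : ℤ) by push_cast; omega)
      push_cast at *
      omega
  have hdown : ∀ n : ℕ, c (-n) ≤ c 0 - n := by
    intro n
    induction n with
    | zero => simp
    | succ n ih =>
      have := h (show -((n + 1 : ℕ) : ℤ) < -(n : ℤ) by push_cast; omega)
      push_cast at *
      omega
  obtain ⟨t, ht, hmax⟩ := Int.exists_greatest_of_bdd (P := fun t => c t ≤ s)
    ⟨(s - c 0).toNat, fun t ht => by
      by_contra hlt
      have h1 := hup t.toNat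
      rw [Int.toNat_of_nonneg (by omega)] at h1
      omega⟩
    ⟨-((c 0 - s).toNat : ℤ), by
      have h1 := hdown (c 0 - s).toNat
      omega⟩
  refine ⟨t, ht, ?_⟩
  by_contra hlt
  have := hmax (t + 1) (by omega)
  omega

theorem IsCut.translate (h : IsCut τ x y c) (t : ℤ) :
    IsCut τ x (fun i => y (i + t)) (fun i => c (i + t)) := by
  intro i
  have := h (i + t)
  rwa [show i + t + 1 = i + 1 + t by ring] at this

theorem IsCut.translate_right (h : IsCut τ x y c) (t : ℤ) :
    IsCut τ (fun i => x (i + t)) y (fun i => c i - t) := by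
  intro i
  have := h i
  refine ⟨by dsimp only; omega, ?_⟩
  rw [window_translate, sub_add_cancel]
  exact this.2

theorem IsCut.window_flatMap (h : IsCut τ x y c) (i : ℤ) (n : ℕ) :
    c (i + n) = c i + (((window y i n).flatMap τ).length : ℤ) ∧
      window x (c i) ((window y i n).flatMap τ).length = (window y i n).flatMap τ := by
  induction n generalizing i with
  | zero => simp
  | succ n ih =>
    obtain ⟨h1, h2⟩ := ih (i + 1)
    obtain ⟨h3, h4⟩ := h i
    rw [window_succ, List.flatMap_cons, List.length_append, window_add, h4]
    constructor
    · rw [show i + ((n + 1 : ℕ) : ℤ) = i + 1 + n by push_cast; ring, h1, h3]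
      push_cast
      ring
    · rw [← h3, h2]

theorem IsCut.eq_of_eq (hτ : ∀ b, τ b ≠ []) {x' : ℤ → A} (h : IsCut τ x y c)
    (h' : IsCut τ x' y c) : x = x' := by
  funext s
  obtain ⟨t, h1, h2⟩ := exists_mem_Ico_of_strictMono (h.strictMono hτ) s
  obtain ⟨h3, h4⟩ := h t
  obtain ⟨-, h5⟩ := h' t
  rw [window_eq_iff] at h4 h5
  have h6 := h4 (s - c t).toNat (by omega)
  have h7 := h5 (s - c t).toNat (by omega)
  rw [show c t + ((s - c t).toNat : ℤ) = s by omega] at h6 h7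
  rw [h6, h7]

/-- Every sequence of block types is the sequence of types of a bi-infinite word cut into blocks. -/
theorem exists_isCut (hτ : ∀ b, τ b ≠ []) (y : ℤ → A) (p : ℤ) :
    ∃ (x : ℤ → A) (c : ℤ → ℤ), IsCut τ x y c ∧ c 0 = p := by
  let l : ℤ → ℤ := fun i => ((τ (y i)).length : ℤ)
  -- Signed partial sums of block lengths: `toNat` empties the first sum for `i ≤ 0` and the second
  -- for `i ≥ 0`.
  let c : ℤ → ℤ := fun i => p + ∑ j ∈ Finset.range i.toNat, l j
    - ∑ j ∈ Finset.range (-i).toNat, l (-(j : ℤ) - 1)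
  have hc : ∀ i, c (i + 1) = c i + l i := by
    intro i
    rcases lt_or_ge i 0 with hi | hi
    · obtain ⟨n, rfl⟩ : ∃ n : ℕ, i = -(n : ℤ) - 1 := ⟨(-i - 1).toNat, by omega⟩
      simp only [c]
      rw [show (-(n : ℤ) - 1 + 1).toNat = 0 by omega, show (-(-(n : ℤ) - 1 + 1)).toNat = n by omega,
        show (-(n : ℤ) - 1).toNat = 0 by omega, show (-(-(n : ℤ) - 1)).toNat = n + 1 by omega,
        Finset.sum_range_succ]
      ring
    · obtain ⟨n, rfl⟩ : ∃ n : ℕ, i = n := ⟨i.toNat, by omega⟩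
      simp only [c]
      rw [show ((n : ℤ) + 1).toNat = n + 1 by omega, show (-((n : ℤ) + 1)).toNat = 0 by omega,
        show (n : ℤ).toNat = n by omega, show (-(n : ℤ)).toNat = 0 by omega,
        Finset.sum_range_succ]
      ring
  have hmono : StrictMono c := strictMono_int_of_lt_succ fun i => by
    have := length_pos_of_forall_ne_nil hτ (y i)
    rw [hc]
    simp only [l]
    omega
  choose t ht1 ht2 using exists_mem_Ico_of_strictMono hmono
  have hlt : ∀ s, (s - c (t s)).toNat < (τ (y (t s))).length := fun s => by
    have h1 := ht1 s
    have h2 := ht2 s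
    rw [hc] at h2
    simp only [l] at h2
    omega
  refine ⟨fun s => (τ (y (t s)))[(s - c (t s)).toNat]'(hlt s), c,
    fun i => ⟨hc i, (window_eq_iff _ _ _).2 fun j hj => ?_⟩, by simp [c]⟩
  have hi : t (c i + j) = i := by
    have h1 := ht1 (c i + j)
    have h2 := ht2 (c i + j)
    have h3 := hc i
    simp only [l] at h3
    have h4 : c (t (c i + j)) < c (i + 1) := by omega
    have h5 : c i < c (t (c i + j) + 1) := by omega
    rw [hmono.lt_iff_lt] at h4 h5
    omega
  simp [hi]

theorem IsCut.comp {z : ℤ → A} {d e : ℤ → ℤ} (hd : IsCut τ' x z d) (he : IsCut τ z y e) :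
    IsCut (fun b => (τ b).flatMap τ') x y (fun i => d (e i)) := by
  intro i
  have h1 := hd.window_flatMap (e i) (τ (y i)).length
  rw [(he i).2, ← (he i).1] at h1
  exact h1

/-- A decomposition into the blocks of a composed map factors. -/
theorem IsCut.exists_factor (hτ : ∀ b, τ b ≠ []) (hτ' : ∀ b, τ' b ≠ [])
    (h : IsCut (fun b => (τ b).flatMap τ') x y c) :
    ∃ (z : ℤ → A) (d e : ℤ → ℤ), IsCut τ' x z d ∧ IsCut τ z y e ∧ ∀ i, c i = d (e i) := by
  -- The intermediate word is assembled from the types `y`, not extracted from `x`. The resulting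
  -- `x'` has the cuts and block contents of `x`, hence equals it.
  obtain ⟨z, e, he, he0⟩ := exists_isCut hτ y 0
  obtain ⟨x', d, hd, hd0⟩ := exists_isCut hτ' z (c 0)
  have hne : ∀ b, (fun b => (τ b).flatMap τ') b ≠ [] := by
    intro b hb
    have hb' : (τ b).flatMap τ' = [] := hb
    rw [List.flatMap_eq_nil_iff] at hb'
    obtain ⟨q, hq⟩ := List.exists_mem_of_ne_nil _ (hτ b)
    exact hτ' q (hb' q hq)
  have hstep : ∀ i, d (e (i + 1)) = d (e i) + (((τ (y i)).flatMap τ').length : ℤ) ∧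
      window x' (d (e i)) ((τ (y i)).flatMap τ').length = (τ (y i)).flatMap τ' := hd.comp he
  have hce : ∀ i, c i = d (e i) := by
    intro i
    induction i using Int.induction_on with
    | zero => rw [he0, hd0]
    | succ i ih => rw [(h i).1, (hstep i).1, ih]
    | pred i ih =>
      have h1 := (h (-(i : ℤ) - 1)).1
      have h2 := (hstep (-(i : ℤ) - 1)).1
      rw [sub_add_cancel] at h1 h2
      dsimp only at h1 h2
      omega
  have hx : x = x' := by
    refine h.eq_of_eq hne fun i => ⟨(h i).1, ?_⟩
    rw [hce]
    exact (hstep i).2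
  subst hx
  exact ⟨z, d, e, hd, he, hce⟩

/-- Two strictly increasing bi-infinite sequences with the same range are translates. -/
theorem exists_translate_of_range_eq {c c' : ℤ → ℤ} (h : StrictMono c) (h' : StrictMono c')
    (hr : Set.range c = Set.range c') : ∃ t, ∀ i, c' i = c (i + t) := by
  have hsub : ∀ i, ∃ j, c j = c' i := fun i => by
    have : c' i ∈ Set.range c := hr ▸ ⟨i, rfl⟩
    exact this
  have hsub' : ∀ i, ∃ j, c' j = c i := fun i => by
    have : c i ∈ Set.range c' := hr ▸ ⟨i, rfl⟩
    exact this
  obtain ⟨t, ht⟩ := hsub 0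
  -- Equal ranges leave no room for a term of one sequence strictly between consecutive terms of the
  -- other.
  have key : ∀ i j, c' i = c j → c' (i + 1) = c (j + 1) ∧ c' (i - 1) = c (j - 1) := by
    intro i j hij
    obtain ⟨p, hp⟩ := hsub (i + 1)
    obtain ⟨q, hq⟩ := hsub' (j + 1)
    obtain ⟨p', hp'⟩ := hsub (i - 1)
    obtain ⟨q', hq'⟩ := hsub' (j - 1)
    have h1 : c j < c p := by rw [hp, ← hij]; exact h' (by omega)
    have h2 : c' i < c' q := by rw [hq, hij]; exact h (by omega)
    have h3 : c p' < c j := by rw [hp', ← hij]; exact h' (by omega)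
    have h4 : c' q' < c' i := by rw [hq', hij]; exact h (by omega)
    rw [h.lt_iff_lt] at h1 h3
    rw [h'.lt_iff_lt] at h2 h4
    have h5 : c (j + 1) ≤ c p := h.monotone (by omega)
    have h6 : c' (i + 1) ≤ c' q := h'.monotone (by omega)
    have h7 : c p' ≤ c (j - 1) := h.monotone (by omega)
    have h8 : c' q' ≤ c' (i - 1) := h'.monotone (by omega)
    constructor <;> omega
  refine ⟨t, fun i => ?_⟩
  induction i using Int.induction_on with
  | zero => simp [ht]
  | succ i ih => rw [(key _ _ ih).1]; congr 1; ring
  | pred i ih => rw [(key _ _ ih).2]; congr 1; ring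

/-- `x` has at most one decomposition into blocks `τ (y i)`, up to the numbering of the blocks. -/
def UniqueCut (τ : A → List A) (x : ℤ → A) : Prop :=
  ∀ y c y' c', IsCut τ x y c → IsCut τ x y' c' →
    ∃ t, (∀ i, y' i = y (i + t)) ∧ ∀ i, c' i = c (i + t)

/-- Both cuts factor through intermediate words, which agree up to a translation by uniqueness for
`τ'`; once this is undone, both inner cuts are cuts of the same `z`. -/
theorem UniqueCut.flatMap (hτ : ∀ b, τ b ≠ []) (hτ' : ∀ b, τ' b ≠ []) (h : UniqueCut τ' x)
    (hz : ∀ z d, IsCut τ' x z d → UniqueCut τ z) :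
    UniqueCut (fun b => (τ b).flatMap τ') x := by
  intro y c y' c' hy hy'
  obtain ⟨z, d, e, hd, he, hc⟩ := hy.exists_factor hτ hτ'
  obtain ⟨z', d', e', hd', he', hc'⟩ := hy'.exists_factor hτ hτ'
  obtain ⟨t, ht1, ht2⟩ := h z d z' d' hd hd'
  have he2 : IsCut τ z y' (fun i => e' i + t) := by
    have h1 := he'.translate_right (-t)
    simp only [ht1, sub_neg_eq_add, neg_add_cancel_right] at h1
    exact h1
  obtain ⟨t', ht1', ht2'⟩ := hz z d hd y e y' _ he he2
  refine ⟨t', ht1', fun i => ?_⟩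
  rw [hc', ht2, hc, ← ht2']

end Words

/-! ### Iterated supertiles and the reduction of recognizability to level one -/

section General

variable {A : Type*} [TopologicalSpace A] (ρ : Substitution A)

theorem Substitution.iterate_flatMap (k : ℕ) (w : List A) :
    (fun w : List A => w.flatMap ρ.toFun)^[k] w = w.flatMap (ρ.supertile k) := by
  induction k generalizing w with
  | zero =>
    simp only [Function.iterate_zero, id_eq]
    exact (List.flatMap_singleton' w).symm
  | succ k ih =>
    rw [Function.iterate_succ_apply', ih, List.flatMap_assoc]
    congr 1
    funext b
    rw [supertile, supertile, Function.iterate_succ_apply']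

theorem Substitution.supertile_add (m n : ℕ) (b : A) :
    ρ.supertile (m + n) b = (ρ.supertile m b).flatMap (ρ.supertile n) := by
  rw [← iterate_flatMap, supertile, add_comm, Function.iterate_add_apply, supertile]

theorem Substitution.supertile_one : ρ.supertile 1 = ρ.toFun := by
  funext b
  simp [supertile]

theorem Substitution.supertile_succ (k : ℕ) (b : A) :
    ρ.supertile (k + 1) b = (ρ.toFun b).flatMap (ρ.supertile k) := by
  rw [add_comm, supertile_add, supertile_one]

theorem Substitution.supertile_succ' (k : ℕ) (b : A) :
    ρ.supertile (k + 1) b = (ρ.supertile k b).flatMap ρ.toFun := by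
  rw [supertile_add, supertile_one]

theorem Substitution.supertile_ne_nil (k : ℕ) (b : A) : ρ.supertile k b ≠ [] := by
  induction k with
  | zero => simp [supertile]
  | succ k ih =>
    have h1 := length_le_length_flatMap ρ.ne_nil (ρ.supertile k b)
    have h2 := List.length_pos_of_ne_nil ih
    rw [← supertile_succ'] at h1
    exact List.ne_nil_of_length_pos (by omega)

theorem Substitution.isDecomposition_iff (k : ℕ) (x y : ℤ → A) (c : ℤ → ℤ) :
    ρ.IsDecomposition k x y c ↔ c 0 ≤ 0 ∧ 0 < c 1 ∧ IsCut (ρ.supertile k) x y c := by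
  simp only [IsDecomposition, IsCut, window_eq_iff]

theorem Substitution.mem_subshift_iff (x : ℤ → A) :
    x ∈ ρ.subshift ↔ ∀ i n, window x i n ∈ ρ.language := Iff.rfl

theorem Substitution.translate_mem_subshift {x : ℤ → A} (hx : x ∈ ρ.subshift) (t : ℤ) :
    (fun i => x (i + t)) ∈ ρ.subshift := by
  rw [mem_subshift_iff] at hx ⊢
  intro i n
  rw [window_translate]
  exact hx _ _

theorem Substitution.exists_isCut_supertile
    (hex : ∀ x ∈ ρ.subshift, ∃ y c, y ∈ ρ.subshift ∧ IsCut ρ.toFun x y c)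
    (k : ℕ) (x : ℤ → A) (hx : x ∈ ρ.subshift) :
    ∃ y c, y ∈ ρ.subshift ∧ IsCut (ρ.supertile k) x y c := by
  induction k with
  | zero =>
    refine ⟨x, id, hx, fun i => ?_⟩
    simp [supertile, window_succ]
  | succ k ih =>
    obtain ⟨z, d, hz, hd⟩ := ih
    obtain ⟨y, e, hy, he⟩ := hex z hz
    refine ⟨y, fun i => d (e i), hy, ?_⟩
    rw [show ρ.supertile (k + 1) = fun b => (ρ.toFun b).flatMap (ρ.supertile k) from
      funext (ρ.supertile_succ k)]
    exact hd.comp he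

/-- A substitution is recognizable if the elements of the subshift can be desubstituted within the
subshift, and are uniquely cut into level-1 supertiles. -/
theorem Substitution.isRecognizable_of_uniqueCut
    (hex : ∀ x ∈ ρ.subshift, ∃ y c, y ∈ ρ.subshift ∧ IsCut ρ.toFun x y c)
    (huniq : ∀ x ∈ ρ.subshift, UniqueCut ρ.toFun x) : ρ.IsRecognizable := by
  have hall : ∀ k, ∀ x ∈ ρ.subshift, UniqueCut (ρ.supertile (k + 1)) x := by
    intro k
    induction k with
    | zero => simpa only [zero_add, supertile_one] using huniq
    | succ k ih =>
      intro x hx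
      rw [show ρ.supertile (k + 1 + 1) = fun b => (ρ.supertile (k + 1) b).flatMap ρ.toFun from
        funext (ρ.supertile_succ' (k + 1))]
      refine UniqueCut.flatMap (ρ.supertile_ne_nil _) ρ.ne_nil (huniq x hx) fun z d hz => ?_
      -- The arbitrary `z` is a translate of a word of the subshift, so the induction hypothesis
      -- applies to it.
      obtain ⟨y, c, hy, hc⟩ := hex x hx
      obtain ⟨t, ht, -⟩ := huniq x hx y c z d hc hz
      have : z = fun i => y (i + t) := funext ht
      rw [this]
      exact ih _ (ρ.translate_mem_subshift hy t)
  intro k hk x hx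
  obtain ⟨y, c, hy, hc⟩ := ρ.exists_isCut_supertile hex k x hx
  have hmono := hc.strictMono (ρ.supertile_ne_nil k)
  obtain ⟨t, ht1, ht2⟩ := exists_mem_Ico_of_strictMono hmono 0
  refine ⟨fun i => y (i + t), fun i => c (i + t), ρ.translate_mem_subshift hy t,
    (ρ.isDecomposition_iff _ _ _ _).2 ⟨by simpa using ht1, by simpa [add_comm] using ht2,
      hc.translate t⟩, ?_⟩
  intro y' c' h'
  obtain ⟨h1, h2, h3⟩ := (ρ.isDecomposition_iff _ _ _ _).1 h'
  obtain ⟨k, rfl⟩ : ∃ l, k = l + 1 := ⟨k - 1, by omega⟩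
  obtain ⟨s, hs1, hs2⟩ := hall k x hx y c y' c' hc h3
  -- Block `0` covers position `0` in both numberings, which removes the freedom of translation.
  have hst : s = t := by
    rw [hs2, zero_add] at h1
    rw [hs2, add_comm] at h2
    have h4 := hmono.lt_iff_lt.1 (h1.trans_lt ht2)
    have h5 := hmono.lt_iff_lt.1 (ht1.trans_lt h2)
    omega
  subst hst
  exact ⟨funext hs1, funext hs2⟩

end General

/-! ## Existence of desubstitutions -/

section Desubstitution

variable {A : Type*} [TopologicalSpace A]

/-- A default value makes the letter at `j` a function on words of all lengths, so limits can be
taken letter by letter. -/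
theorem continuous_getD (j : ℕ) (d : A) : Continuous (fun l : List A => l.getD j d) := by
  rw [continuous_iff_continuousAt]
  intro l
  induction j generalizing l with
  | zero =>
    cases l with
    | nil =>
      rw [ContinuousAt, nhds_nil]
      exact tendsto_pure_nhds _ _
    | cons b l =>
      rw [ContinuousAt, List.tendsto_cons_iff]
      simpa using Filter.tendsto_fst
  | succ j ih =>
    cases l with
    | nil =>
      rw [ContinuousAt, nhds_nil]
      exact tendsto_pure_nhds _ _
    | cons b l =>
      rw [ContinuousAt, List.tendsto_cons_iff]
      exact (ih l).tendsto.comp Filter.tendsto_snd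

theorem continuous_window (i : ℤ) (n : ℕ) : Continuous (fun x : ℤ → A => window x i n) := by
  induction n generalizing i with
  | zero => simpa using continuous_const
  | succ n ih =>
    simp only [window_succ]
    exact List.continuous_cons.comp ((continuous_apply i).prodMk (ih (i + 1)))

variable (ρ : Substitution A)

/-- The elements of the subshift are approximated by bi-infinite words that are cut into level-1
supertiles whose types form, on a long window, a subword of a supertile. -/
theorem Substitution.exists_isCut_near {B : ℕ} (hB : ∀ b, (ρ.toFun b).length ≤ B)
    {x : ℤ → A} (hx : x ∈ ρ.subshift) (n : ℕ) {V : Set (ℤ → A)} (hV : V ∈ 𝓝 x) :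
    ∃ (y s x' : ℤ → A) (c : ℤ → ℤ), x' ∈ V ∧ IsCut ρ.toFun s y c ∧ c 0 ≤ 0 ∧ 0 < c 1 ∧
      (∀ t : ℤ, |t| ≤ n → s t = x' t) ∧
      ∀ i : ℤ, |i| ≤ n → ∃ (k : ℕ) (b : A), window y i n <:+: ρ.supertile k b := by
  -- Radius `2nB` leaves room for `2n` blocks on each side of the origin; `m > 0` makes the
  -- approximating word too long to be a level-0 supertile.
  obtain ⟨m, hm1, hm2, hm3⟩ : ∃ m : ℕ, n ≤ m ∧ 2 * n * B ≤ m ∧ 0 < m :=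
    ⟨n + 2 * n * B + 1, by omega, by omega, by omega⟩
  -- `g l` overwrites `x` on `[-m, m]` by `l`, turning the neighbourhood `V` of `x` into a
  -- neighbourhood of its central window.
  let g : List A → ℤ → A := fun l t => if |t| ≤ m then l.getD (t + m).toNat (x t) else x t
  have hg : Continuous g := by
    refine continuous_pi fun t => ?_
    by_cases ht : |t| ≤ m
    · simpa only [g, ht, if_true] using continuous_getD _ _
    · simpa only [g, ht, if_false] using continuous_const
  have hgx : g (window x (-m) (2 * m + 1)) = x := by
    funext t
    by_cases ht : |t| ≤ m
    · rw [abs_le] at ht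
      have hlt : (t + m).toNat < (window x (-m) (2 * m + 1)).length := by
        rw [length_window]; omega
      simp only [g, abs_le, ht, and_self, if_true]
      rw [List.getD_eq_getElem _ _ hlt, getElem_window]
      congr 1
      omega
    · simp only [g, ht, if_false]
  have hmem : window x (-m) (2 * m + 1) ∈ ρ.language := hx _ _
  rw [language, mem_closure_iff_nhds] at hmem
  obtain ⟨l, ⟨hl1, hl2⟩, K, b, hl3⟩ := hmem ((g ⁻¹' V) ∩ List.length ⁻¹' {2 * m + 1}) <| by
    refine Filter.inter_mem (hg.continuousAt.preimage_mem_nhds (by rwa [hgx])) ?_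
    refine (List.continuousAt_length _).preimage_mem_nhds ?_
    rw [length_window]
    exact mem_nhds_discrete.2 rfl
  have hlen : l.length = 2 * m + 1 := hl2
  obtain ⟨k, rfl⟩ : ∃ k, K = k + 1 := by
    cases K with
    | zero =>
      have := hl3.length_le
      simp [supertile] at this
      omega
    | succ k => exact ⟨k, rfl⟩
  obtain ⟨u, v, huv⟩ := hl3
  rw [supertile_succ'] at huv
  set W := ρ.supertile k b with hW
  -- `W` is padded to a bi-infinite word of types; the position of cut `0` puts `l`, which follows
  -- `u`, at `-m`.
  obtain ⟨s, c, hc, hc0⟩ := exists_isCut ρ.ne_nil (fun i : ℤ => W.getD i.toNat b)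
    (-((u.length + m : ℕ) : ℤ))
  set y : ℤ → A := fun i => W.getD i.toNat b with hy
  have hyW : window y 0 W.length = W := by
    rw [window_eq_iff]
    intro j hj
    simp [hy, hj]
  have hmono := hc.strictMono ρ.ne_nil
  obtain ⟨h1, h2⟩ := hc.window_flatMap 0 W.length
  rw [hyW, ← huv, hc0] at h1 h2
  have h3 : window s (-(m : ℤ)) (2 * m + 1) = l := by
    rw [List.length_append, List.length_append, window_add, window_add] at h2
    have h4 := List.append_inj_left h2 (by simp)
    have h5 := List.append_inj_right h4 (by simp)
    rw [hlen] at h5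
    rw [← h5]
    congr 1
    push_cast
    ring
  have hstep : ∀ (j : ℕ) (i : ℤ), c (i + j) ≤ c i + j * B := by
    intro j i
    induction j with
    | zero => simp
    | succ j ih =>
      have h5 := (hc (i + j)).1
      have h6 := hB (y (i + j))
      push_cast
      rw [← add_assoc, h5]
      push_cast at *
      nlinarith
  obtain ⟨t, ht1, ht2⟩ := exists_mem_Ico_of_strictMono hmono 0
  have hnB : (2 * (n : ℤ)) * B ≤ m := by exact_mod_cast hm2
  have htn : (n : ℤ) ≤ t := by
    have h5 := hstep n 0
    rw [hc0, zero_add] at h5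
    have h6 : c n < c (t + 1) := by
      push_cast at h5
      have : (0 : ℤ) ≤ n * B := by positivity
      linarith
    rw [hmono.lt_iff_lt] at h6
    omega
  have htW : t + 2 * n < W.length := by
    have h5 := hstep (2 * n) ((W.length : ℤ) - 2 * n)
    rw [show ((W.length : ℤ) - 2 * n) + ((2 * n : ℕ) : ℤ) = 0 + W.length by push_cast; ring, h1]
      at h5
    have h6 : c t < c ((W.length : ℤ) - 2 * n) := by
      rw [List.length_append, List.length_append, hlen] at h5
      push_cast at h5
      linarith
    rw [hmono.lt_iff_lt] at h6
    omega
  refine ⟨fun i => y (i + t), s, g l, fun i => c (i + t), hl1, hc.translate t, by simpa using ht1,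
    by simpa [add_comm] using ht2, fun r hr => ?_, fun i hi => ⟨k, b, ?_⟩⟩
  · have hr' : |r| ≤ m := hr.trans (by exact_mod_cast hm1)
    simp only [g, hr', if_true]
    rw [abs_le] at hr'
    rw [List.getD_eq_getElem _ _ (by omega)]
    simp only [← h3]
    rw [getElem_window]
    congr 1
    omega
  · rw [window_translate]
    rw [abs_le] at hi
    exact window_infix_of_window_eq hyW _ _ (by omega) (by omega)

/-- Over a compact first-countable alphabet, every element of the subshift is cut into level-1
supertiles whose types form an element of the subshift. -/
theorem Substitution.exists_isCut_mem_subshift [CompactSpace A] [T2Space A]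
    [FirstCountableTopology A] {x : ℤ → A} (hx : x ∈ ρ.subshift) :
    ∃ y c, y ∈ ρ.subshift ∧ IsCut ρ.toFun x y c := by
  obtain ⟨B, hB⟩ := ρ.exists_length_le
  obtain ⟨V, hV⟩ := (𝓝 x).exists_antitone_basis
  choose y s x' c hxV hc hc0 hc1 hs hy using
    fun n => ρ.exists_isCut_near hB hx n (hV.1.mem_of_mem (i := n) trivial)
  have hx' : Filter.Tendsto x' Filter.atTop (𝓝 x) := hV.tendsto hxV
  -- Along an ultrafilter the types converge by compactness, and each cut position, confined to a
  -- finite interval, becomes constant.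
  let U : Ultrafilter ℕ := Filter.hyperfilter ℕ
  have hU : (U : Filter ℕ) ≤ Filter.atTop := by
    rw [← Nat.cofinite_eq_atTop]
    exact Filter.hyperfilter_le_cofinite
  obtain ⟨z, -, hz⟩ := isCompact_univ.ultrafilter_le_nhds (U.map y) (by simp)
  have hz' : Filter.Tendsto y U (𝓝 z) := hz
  have hzi : ∀ i, Filter.Tendsto (fun n => y n i) U (𝓝 (z i)) := fun i =>
    ((continuous_apply i).tendsto z).comp hz'
  -- The normalisation `c 0 ≤ 0 < c 1` and the length bound `B` confine cut number `i`, uniformly in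
  -- `n`.
  have hbound : ∀ n (i : ℤ), |c n i| ≤ B * (|i| + 1) := by
    intro n
    have hlen : ∀ i, c n (i + 1) ≤ c n i + B ∧ c n i ≤ c n (i + 1) := fun i => by
      have h1 := (hc n i).1
      have h2 := hB (y n i)
      omega
    have h0 : -B ≤ c n 0 := by have h1 := hlen 0; have h2 := hc1 n; simp only [zero_add] at h1; omega
    have key : ∀ i : ℕ, (0 ≤ c n i + B ∧ c n i ≤ B * i) ∧
        (c n (-i) ≤ 0 ∧ -(B : ℤ) * (i + 1) ≤ c n (-i)) := by
      intro i
      induction i with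
      | zero => simpa using ⟨⟨by omega, hc0 n⟩, hc0 n, by omega⟩
      | succ i ih =>
        have h1 := hlen i
        have h2 := hlen (-(i : ℤ) - 1)
        rw [sub_add_cancel] at h2
        push_cast
        rw [show -((i : ℤ) + 1) = -(i : ℤ) - 1 by ring]
        refine ⟨⟨by omega, by nlinarith⟩, by omega, by nlinarith⟩
    intro i
    rcases le_total 0 i with hi | hi
    · obtain ⟨j, rfl⟩ := Int.eq_ofNat_of_zero_le hi
      obtain ⟨⟨h1, h2⟩, -⟩ := key j
      have : (0 : ℤ) ≤ B * j := by positivity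
      rw [abs_of_nonneg hi, abs_le]
      constructor <;> nlinarith
    · obtain ⟨j, hj⟩ := Int.eq_ofNat_of_zero_le (neg_nonneg.2 hi)
      obtain ⟨-, h1, h2⟩ := key j
      obtain rfl : i = -j := by omega
      have : (0 : ℤ) ≤ B * j := by positivity
      rw [abs_neg, abs_of_nonneg (Int.natCast_nonneg j), abs_le]
      constructor <;> nlinarith
  have hlim : ∀ i, ∃ v, ∀ᶠ n in (U : Filter ℕ), c n i = v := by
    intro i
    have hfin := Set.finite_Icc (-(B * (|i| + 1) : ℤ)) (B * (|i| + 1))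
    have hev : ∀ᶠ n in (U : Filter ℕ), ∃ v ∈ Set.Icc (-(B * (|i| + 1) : ℤ)) (B * (|i| + 1)),
        c n i = v := Filter.Eventually.of_forall fun n => ⟨_, abs_le.1 (hbound n i), rfl⟩
    obtain ⟨v, -, hv⟩ := (Ultrafilter.eventually_exists_mem_iff hfin).1 hev
    exact ⟨v, hv⟩
  choose d hd using hlim
  have hlen : ∀ i, ∀ᶠ n in (U : Filter ℕ),
      (ρ.toFun (y n i)).length = (ρ.toFun (z i)).length := by
    intro i
    have h1 : Continuous fun b => (ρ.toFun b).length :=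
      (continuous_iff_continuousAt.2 List.continuousAt_length).comp ρ.continuous_toFun
    have h2 := (h1.tendsto (z i)).comp (hzi i)
    rw [nhds_discrete, Filter.tendsto_pure] at h2
    exact h2
  have hsx : ∀ t, Filter.Tendsto (fun n => s n t) U (𝓝 (x t)) := by
    intro t
    have h1 : Filter.Tendsto (fun n => x' n t) U (𝓝 (x t)) :=
      ((continuous_apply t).tendsto x).comp (hx'.mono_left hU)
    refine h1.congr' ?_
    filter_upwards [hU (Filter.eventually_ge_atTop t.natAbs)] with n hn
    have hn' : t.natAbs ≤ n := hn
    exact (hs n t (by rw [Int.abs_eq_natAbs]; exact_mod_cast hn')).symm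
  refine ⟨z, d, ?_, fun i => ⟨?_, (window_eq_iff _ _ _).2 fun j hj => ?_⟩⟩
  · rw [mem_subshift_iff]
    intro i n
    refine mem_closure_of_tendsto (((continuous_window i n).tendsto z).comp hz') ?_
    filter_upwards [hU (Filter.eventually_ge_atTop (n + i.natAbs))] with m hm
    have hm' : n + i.natAbs ≤ m := hm
    obtain ⟨k, b, hkb⟩ := hy m i (by rw [Int.abs_eq_natAbs]; exact_mod_cast (by omega))
    refine ⟨k, b, List.IsInfix.trans ?_ hkb⟩
    obtain ⟨r, rfl⟩ : ∃ r, m = n + r := ⟨m - n, by omega⟩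
    rw [window_add]
    exact (List.prefix_append _ _).isInfix
  · obtain ⟨n, h1, h2, h3⟩ := ((hd i).and ((hd (i + 1)).and (hlen i))).exists
    rw [← h1, ← h2, ← h3]
    exact (hc n i).1
  · have h1 : Filter.Tendsto (fun n => (ρ.toFun (y n i)).getD j (x 0)) U
        (𝓝 ((ρ.toFun (z i)).getD j (x 0))) :=
      (((continuous_getD j (x 0)).comp ρ.continuous_toFun).tendsto (z i)).comp (hzi i)
    rw [List.getD_eq_getElem _ _ hj] at h1
    refine tendsto_nhds_unique ((hsx (d i + j)).congr' ?_) h1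
    filter_upwards [hd i, hlen i] with n h2 h3
    rw [List.getD_eq_getElem _ _ (by omega), ← h2]
    exact (window_eq_iff _ _ _).1 (hc n i).2 j (by omega)

end Desubstitution

/-! ## Combinatorics of the substitution on the compact alphabet -/

theorem length_mul_le_length_flatMap {A : Type*} {τ : A → List A} {L : ℕ}
    (h : ∀ b, L ≤ (τ b).length) (w : List A) : w.length * L ≤ (w.flatMap τ).length := by
  induction w with
  | nil => simp
  | cons b w ih =>
    have := h b
    simp only [List.flatMap_cons, List.length_append, List.length_cons, add_mul, one_mul]
    omega

theorem Substitution.mem_supertile_add {A : Type*} [TopologicalSpace A] (ρ : Substitution A)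
    {m n : ℕ} {b c d : A} (h : c ∈ ρ.supertile m b) (h' : d ∈ ρ.supertile n c) :
    d ∈ ρ.supertile (m + n) b := by
  rw [supertile_add]
  exact List.mem_flatMap.2 ⟨c, h, h'⟩

theorem Substitution.self_mem_supertile {A : Type*} [TopologicalSpace A] (ρ : Substitution A)
    {b : A} (h : b ∈ ρ.toFun b) (k : ℕ) : b ∈ ρ.supertile k b := by
  induction k with
  | zero => simp [supertile]
  | succ k ih =>
    rw [supertile_succ]
    exact List.mem_flatMap.2 ⟨b, h, ih⟩

theorem countOutside_append {A : Type*} (F : Set A) (w w' : List A) :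
    countOutside F (w ++ w') = countOutside F w + countOutside F w' :=
  List.countP_append

theorem countOutside_eq_zero {A : Type*} {F : Set A} {w : List A} (h : ∀ c ∈ w, c ∈ F) :
    countOutside F w = 0 := by
  rw [countOutside, List.countP_eq_zero]
  intro c hc
  simpa using h c hc

section Alphabet

variable {N : ℕ} (a : ℕ → Fin (N + 1))

theorem eq_letter_zero_of_eq_star (b : Alphabet a) (h : b.1 (-1) = asterisk) : b = letter a 0 := by
  by_cases hb : b.1 ∈ Set.range (embed a)
  · obtain ⟨i, hi⟩ := hb
    cases i with
    | zero => exact Subtype.ext hi.symm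
    | succ i => exact absurd (by rw [hi, h]) (embed_succ_neg_one a i)
  · exact absurd h (ne_star_of_infinity a b hb _)

theorem apply_zero_ne_star (b : Alphabet a) : b.1 0 ≠ asterisk := by
  by_cases hb : b.1 ∈ Set.range (embed a)
  · obtain ⟨i, hi⟩ := hb
    rw [← hi, embed_apply_zero]
    exact num_ne_star _
  · exact ne_star_of_infinity a b hb _

/-- The entry of `next a b` at `-1` is `b.1 0`, which is never `*`. -/
theorem next_ne_letter_zero (b : Alphabet a) : next a b ≠ letter a 0 := by
  intro h
  apply apply_zero_ne_star a b
  have h1 : (next a b).1 (-1) = (letter a 0).1 (-1) := by rw [h]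
  exact h1.trans (embed_zero_neg_one a)

theorem next_injective : Function.Injective (next a) := by
  intro b b' h
  refine Subtype.ext (funext fun m => ?_)
  have h1 : (next a b).1 (m - 1) = (next a b').1 (m - 1) := by rw [h]
  simpa [next, shift] using h1

theorem iterate_next_apply_zero (b : Alphabet a) (t : ℕ) : ((next a)^[t] b).1 0 = b.1 t := by
  have : ∀ m : ℤ, ((next a)^[t] b).1 m = b.1 (m + t) := by
    induction t with
    | zero => simp
    | succ t ih =>
      intro m
      rw [Function.iterate_succ_apply']
      show ((next a)^[t] b).1 (m + 1) = _
      rw [ih]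
      exact congrArg b.1 (by push_cast; ring)
  simpa using this 0

theorem iterate_next_letter_zero (i : ℕ) : (next a)^[i] (letter a 0) = letter a i := by
  induction i with
  | zero => rfl
  | succ i ih => rw [Function.iterate_succ_apply', ih, next_letter]

theorem letter_zero_val : ((letter a 0).1 0).val = (a 0 : ℕ) := by
  show (embed a 0 0).val = _
  rw [embed_apply_zero]
  rfl

theorem exists_substWord_eq (b : Alphabet a) (hb : b ≠ letter a 0) :
    ∃ p, substWord a b = List.replicate (b.1 0).val (letter a 0) ++ [p, next a b] := by
  have h1 : b.1 (-1) ≠ asterisk := fun h => hb (eq_letter_zero_of_eq_star a b h)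
  have h2 : prevWord a b = [⟨unshift b.1, unshift_mem a b h1⟩] := dif_neg h1
  exact ⟨_, by rw [substWord, h2]; rfl⟩

theorem substWord_letter_zero' :
    substWord a (letter a 0) =
      List.replicate ((letter a 0).1 0).val (letter a 0) ++ [next a (letter a 0)] := by
  rw [substWord_letter_zero, letter_zero_val, next_letter]

/-- What precedes the last letter is non-empty because of `a 0 ≠ 0` if `b = [0]`, and because of the
letter `σ⁻¹(b)` otherwise. -/
theorem exists_substWord_eq_append (ha : (a 0 : ℕ) ≠ 0) (b : Alphabet a) :
    ∃ w, w ≠ [] ∧ substWord a b = w ++ [next a b] := by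
  by_cases hb : b = letter a 0
  · subst hb
    exact ⟨_, by simpa [letter_zero_val] using ha, substWord_letter_zero' a⟩
  · obtain ⟨p, hp⟩ := exists_substWord_eq a b hb
    exact ⟨List.replicate (b.1 0).val (letter a 0) ++ [p], by simp, by simp [hp]⟩

theorem two_le_length_substWord (ha : (a 0 : ℕ) ≠ 0) (b : Alphabet a) :
    2 ≤ (substWord a b).length := by
  obtain ⟨w, hw, h⟩ := exists_substWord_eq_append a ha b
  have := List.length_pos_of_ne_nil hw
  rw [h, List.length_append, List.length_singleton]
  omega

theorem iterate_next_mem_supertile (b : Alphabet a) (t : ℕ) :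
    (next a)^[t] b ∈ (substitution a).supertile t b := by
  induction t with
  | zero => simp [Substitution.supertile]
  | succ t ih =>
    rw [Substitution.supertile_succ', Function.iterate_succ_apply']
    exact List.mem_flatMap.2 ⟨_, ih, by simp [substitution, substWord]⟩

theorem letter_zero_mem_substWord (b : Alphabet a) (h : (b.1 0).val ≠ 0) :
    letter a 0 ∈ substWord a b := by
  simp [substWord, h]

/-- In a sequence without long blocks of zeros, every letter has a non-zero entry soon. -/
theorem exists_apply_ne_zero {C : ℕ} (hC : ∀ i, ∃ j ≤ C, (a (i + j) : ℕ) ≠ 0) (b : Alphabet a) :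
    ∃ j : ℕ, j ≤ C ∧ (b.1 j).val ≠ 0 := by
  -- The condition involves finitely many coordinates, hence is closed, and it holds on the dense
  -- set of letters `[i]`.
  have hcl : IsClosed (⋃ j ∈ Set.Iic C, {x : ℤ → Sym N | (x (j : ℕ)).val ≠ 0}) :=
    (Set.finite_Iic C).isClosed_biUnion fun j _ =>
      (isClosed_discrete {s : Sym N | s.val ≠ 0}).preimage
        (continuous_apply (A := fun _ : ℤ => Sym N) ((j : ℕ) : ℤ))
  have hsub : Set.range (embed a) ⊆ ⋃ j ∈ Set.Iic C, {x : ℤ → Sym N | (x (j : ℕ)).val ≠ 0} := by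
    rintro _ ⟨i, rfl⟩
    obtain ⟨j, hj, h⟩ := hC i
    refine Set.mem_biUnion (x := j) hj ?_
    show (embed a i j).val ≠ 0
    rw [embed_apply, zeroPoint, if_pos (by positivity),
      show ((j : ℤ) + i).toNat = i + j by omega]
    exact h
  have hb := closure_minimal hsub hcl b.2
  simpa only [Set.mem_iUnion, Set.mem_Iic, exists_prop, Set.mem_ofPred_eq] using hb

/-- After `j` steps the shifted letter has the non-zero entry `b.1 j` at its origin, so the next
step produces `[0]`; as `a 0 ≠ 0`, `[0]` then reproduces itself for the remaining steps. -/
theorem letter_zero_mem_supertile (ha : (a 0 : ℕ) ≠ 0) {C : ℕ}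
    (hC : ∀ i, ∃ j ≤ C, (a (i + j) : ℕ) ≠ 0) (b : Alphabet a) :
    letter a 0 ∈ (substitution a).supertile (C + 1) b := by
  obtain ⟨j, hj, h⟩ := exists_apply_ne_zero a hC b
  obtain ⟨r, rfl⟩ : ∃ r, C = j + r := ⟨C - j, by omega⟩
  rw [← iterate_next_apply_zero] at h
  rw [show j + r + 1 = j + (1 + r) by ring]
  refine (substitution a).mem_supertile_add (iterate_next_mem_supertile a b j)
    ((substitution a).mem_supertile_add (c := letter a 0) ?_ ?_)
  · rw [Substitution.supertile_one]
    exact letter_zero_mem_substWord a _ h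
  · refine (substitution a).self_mem_supertile (letter_zero_mem_substWord a _ ?_) r
    rwa [letter_zero_val]

theorem substitution_isPrimitive (ha : (a 0 : ℕ) ≠ 0) {C : ℕ}
    (hC : ∀ i, ∃ j ≤ C, (a (i + j) : ℕ) ≠ 0) : (substitution a).IsPrimitive := by
  rintro U hU ⟨x, hx⟩
  obtain ⟨O, hO, rfl⟩ := isOpen_induced_iff.1 hU
  obtain ⟨_, hi, i, rfl⟩ := mem_closure_iff.1 x.2 O hO hx
  refine ⟨C + 1 + i, by omega, fun b => ⟨letter a i, ?_, hi⟩⟩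
  refine (substitution a).mem_supertile_add (letter_zero_mem_supertile a ha hC b) ?_
  have h1 := iterate_next_mem_supertile a (letter a 0) i
  rwa [iterate_next_letter_zero] at h1

/-- `[i]` is the only letter whose last `*` is at position `-i-1`, a condition on two coordinates.
-/
theorem isOpen_singleton_letter (i : ℕ) : IsOpen ({letter a i} : Set (Alphabet a)) := by
  have hc : ∀ m : ℤ, Continuous (fun b : Alphabet a => b.1 m) := fun m =>
    (continuous_apply m).comp continuous_subtype_val
  have hO : IsOpen {b : Alphabet a | b.1 (-(i : ℤ) - 1) = asterisk ∧ b.1 (-(i : ℤ)) ≠ asterisk} :=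
    ((isOpen_discrete {s : Sym N | s = asterisk}).preimage (hc _)).inter
      ((isOpen_discrete {s : Sym N | s ≠ asterisk}).preimage (hc _))
  convert hO
  ext b
  simp only [Set.mem_singleton_iff, Set.mem_ofPred_eq]
  constructor
  · rintro rfl
    constructor
    · show embed a i _ = _
      rw [embed_apply, zeroPoint, if_neg (by omega)]
    · show embed a i _ ≠ _
      rw [embed_apply, zeroPoint, if_pos (by omega)]
      exact num_ne_star _
  · rintro ⟨h1, h2⟩
    by_cases hb : b.1 ∈ Set.range (embed a)
    · obtain ⟨j, hj⟩ := hb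
      rw [← hj, embed_apply, zeroPoint] at h1 h2
      split_ifs at h1 with h3
      · exact absurd h1 (num_ne_star _)
      split_ifs at h2 with h4
      · obtain rfl : j = i := by omega
        exact Subtype.ext hj.symm
      · exact absurd rfl h2
    · exact absurd h1 (ne_star_of_infinity a b hb _)

/-! ### Supertile lengths against the number of letters outside `F` -/

theorem two_pow_le_length_supertile (ha : (a 0 : ℕ) ≠ 0) (k : ℕ) (b : Alphabet a) :
    2 ^ k ≤ ((substitution a).supertile k b).length := by
  induction k generalizing b with
  | zero => simp [Substitution.supertile]
  | succ k ih =>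
    rw [Substitution.supertile_succ, pow_succ, mul_comm]
    exact (Nat.mul_le_mul_right _ (two_le_length_substWord a ha b)).trans
      (length_mul_le_length_flatMap ih _)

/-- All images at least double, and along the branch of iterated `next` a letter with at least three
letters in its image is met before level `k`. -/
theorem two_pow_lt_length_supertile_of_ne (ha : (a 0 : ℕ) ≠ 0) (t : ℕ) (b : Alphabet a)
    (h0 : (next a)^[t] b ≠ letter a 0) (h1 : (((next a)^[t] b).1 0).val ≠ 0) (k : ℕ) (hk : t < k) :
    2 ^ k < ((substitution a).supertile k b).length := by
  obtain ⟨k, rfl⟩ : ∃ l, k = l + 1 := ⟨k - 1, by omega⟩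
  have hpos : 0 < 2 ^ k := by positivity
  induction t generalizing b k with
  | zero =>
    obtain ⟨p, hp⟩ := exists_substWord_eq a b h0
    have h2 := length_mul_le_length_flatMap (two_pow_le_length_supertile a ha k) (substWord a b)
    have h3 : 3 ≤ (substWord a b).length := by
      have : (b.1 0).val ≠ 0 := h1
      rw [hp]
      simp
      omega
    rw [Substitution.supertile_succ, pow_succ]
    refine lt_of_lt_of_le ?_ h2
    nlinarith
  | succ t ih =>
    obtain ⟨k, rfl⟩ : ∃ l, k = l + 1 := ⟨k - 1, by omega⟩
    obtain ⟨w, hw, h⟩ := exists_substWord_eq_append a ha b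
    have h2 := ih (next a b) h0 h1 k (by omega) (by positivity)
    have h3 := length_mul_le_length_flatMap (two_pow_le_length_supertile a ha (k + 1)) w
    have h4 := List.length_pos_of_ne_nil hw
    have h5 : ((substitution a).toFun b) = w ++ [next a b] := h
    rw [Substitution.supertile_succ, h5, List.flatMap_append, List.length_append,
      List.flatMap_singleton, pow_succ]
    nlinarith

/-- The search for a non-zero entry starts at `next a b`, so that the letter found is not `[0]`,
whose image may have only two letters. It is found after at most `C + 1` steps, and its own image
takes one more. -/
theorem two_pow_lt_length_supertile (ha : (a 0 : ℕ) ≠ 0) {C : ℕ}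
    (hC : ∀ i, ∃ j ≤ C, (a (i + j) : ℕ) ≠ 0) (b : Alphabet a) :
    2 ^ (C + 2) < ((substitution a).supertile (C + 2) b).length := by
  obtain ⟨j, hj, h⟩ := exists_apply_ne_zero a hC (next a b)
  refine two_pow_lt_length_supertile_of_ne a ha (j + 1) b ?_ ?_ _ (by omega)
  · rw [Function.iterate_succ_apply']
    exact next_ne_letter_zero a _
  · rwa [Function.iterate_succ_apply, iterate_next_apply_zero]

theorem eq_letter_of_mem_supertile (k i : ℕ) (x : Alphabet a)
    (hx : x ∈ (substitution a).supertile k (letter a i)) : ∃ j ≤ i + k, x = letter a j := by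
  induction k generalizing i with
  | zero => exact ⟨i, le_rfl, by simpa [Substitution.supertile] using hx⟩
  | succ k ih =>
    rw [Substitution.supertile_succ, List.mem_flatMap] at hx
    obtain ⟨c, hc, hxc⟩ := hx
    have hc' : c ∈ substWord a (letter a i) := hc
    obtain ⟨j, hj, rfl⟩ : ∃ j ≤ i + 1, c = letter a j := by
      cases i with
      | zero =>
        rw [substWord_letter_zero, List.mem_append, List.mem_replicate, List.mem_singleton] at hc'
        rcases hc' with ⟨-, h⟩ | h
        · exact ⟨0, by omega, h⟩
        · exact ⟨1, by omega, h⟩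
      | succ i =>
        rw [substWord_letter_succ, List.mem_append, List.mem_replicate, List.mem_pair] at hc'
        rcases hc' with ⟨-, h⟩ | h | h
        · exact ⟨0, by omega, h⟩
        · exact ⟨i, by omega, h⟩
        · exact ⟨i + 2, by omega, h⟩
    obtain ⟨l, hl, rfl⟩ := ih j hxc
    exact ⟨l, by omega, rfl⟩

/-- The leading copies of `[0]` only have descendants of small index, all in the exceptional set, so
at most two letters of each image contribute. -/
theorem countOutside_supertile_le (m k : ℕ) (hk : k ≤ m + 1) (b : Alphabet a) :
    countOutside {x | ∃ i ≤ m, x = letter a i} ((substitution a).supertile k b) ≤ 2 ^ k := by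
  induction k generalizing b with
  | zero =>
    rw [Substitution.supertile, pow_zero]
    exact List.countP_le_length
  | succ k ih =>
    have ih' := ih (by omega)
    have hz : countOutside {x | ∃ i ≤ m, x = letter a i}
        ((List.replicate (b.1 0).val (letter a 0)).flatMap ((substitution a).supertile k)) = 0 := by
      refine countOutside_eq_zero fun c hc => ?_
      obtain ⟨z, hz, hcz⟩ := List.mem_flatMap.1 hc
      rw [(List.mem_replicate.1 hz).2] at hcz
      obtain ⟨j, hj, h⟩ := eq_letter_of_mem_supertile a k 0 c hcz
      exact ⟨j, by omega, h⟩
    have hp : countOutside {x | ∃ i ≤ m, x = letter a i}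
        ((prevWord a b).flatMap ((substitution a).supertile k)) ≤ 2 ^ k := by
      unfold prevWord
      split_ifs with h
      · simp [countOutside]
      · rw [List.flatMap_singleton]
        exact ih' _
    have hn := ih' (next a b)
    rw [Substitution.supertile_succ]
    show countOutside _ ((substWord a b).flatMap _) ≤ _
    rw [substWord, List.flatMap_append, List.flatMap_append, countOutside_append,
      countOutside_append, hz, List.flatMap_singleton, pow_succ]
    omega

/-! ### Unique desubstitution -/

section Unique

variable {a} {x y : ℤ → Alphabet a} {c : ℤ → ℤ}

theorem IsCut.apply_eq_next (h : IsCut (substWord a) x y c) (i : ℤ) :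
    x (c (i + 1) - 1) = next a (y i) := by
  obtain ⟨h1, h2⟩ := h i
  rw [window_eq_iff] at h2
  have hlen : (substWord a (y i)).length =
      (List.replicate ((y i).1 0).val (letter a 0) ++ prevWord a (y i)).length + 1 := by
    simp [substWord]
    ring
  have h3 := h2 (List.replicate ((y i).1 0).val (letter a 0) ++ prevWord a (y i)).length (by omega)
  rw [h1, hlen]
  push_cast
  rw [add_sub_assoc, add_sub_cancel_right, h3]
  simp [substWord]

/-- A position of a cut bi-infinite word is the last one of a block if and only if the letter there
is not `[0]` and the next position is not the last one of a block. -/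
theorem IsCut.mem_range_iff (ha : (a 0 : ℕ) ≠ 0) (h : IsCut (substWord a) x y c) (j : ℤ) :
    j + 1 ∈ Set.range c ↔ x j ≠ letter a 0 ∧ j + 2 ∉ Set.range c := by
  constructor
  · rintro ⟨i, hi⟩
    have h1 := h.apply_eq_next (i - 1)
    rw [sub_add_cancel, hi, add_sub_cancel_right] at h1
    refine ⟨h1 ▸ next_ne_letter_zero a _, ?_⟩
    rintro ⟨i', hi'⟩
    have hmono := h.strictMono (substitution a).ne_nil
    have h2 : i < i' := by rw [← hmono.lt_iff_lt]; omega
    have h3 : c (i + 1) ≤ c i' := hmono.monotone (by omega)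
    have h4 := (h i).1
    have h5 := two_le_length_substWord a ha (y i)
    omega
  · rintro ⟨hx, hj⟩
    by_contra hj'
    apply hj
    obtain ⟨i, hi1, hi2⟩ :=
      exists_mem_Ico_of_strictMono (h.strictMono (substitution a).ne_nil) j
    have hne : j + 1 ≠ c (i + 1) := fun e => hj' ⟨_, e.symm⟩
    obtain ⟨h1, h2⟩ := h i
    rw [window_eq_iff] at h2
    have h3 := h2 (j - c i).toNat (by omega)
    rw [show c i + ((j - c i).toNat : ℤ) = j by omega] at h3
    -- Beyond the run of `[0]` at most two letters remain; since `j` does not end its block, it is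
    -- the last position but one.
    have h4 : ((y i).1 0).val ≤ (j - c i).toNat := by
      by_contra hlt
      apply hx
      rw [h3]
      simp only [substWord]
      rw [List.getElem_append_left (by simpa using hlt), List.getElem_replicate]
    refine ⟨i + 1, ?_⟩
    by_cases hz : y i = letter a 0
    · have h5 : (substWord a (y i)).length = ((y i).1 0).val + 1 := by
        rw [hz, substWord_letter_zero']
        simp
      omega
    · obtain ⟨p, hp⟩ := exists_substWord_eq a (y i) hz
      have h5 : (substWord a (y i)).length = ((y i).1 0).val + 2 := by
        rw [hp]
        simp
      omega

/-- A letter `[0]` never ends a block, and `IsCut.mem_range_iff` carries this knowledge leftwards by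
induction on the distance to the next `[0]`. The types are read off from the last letters of blocks,
`next` being injective. -/
theorem uniqueCut_substWord (ha : (a 0 : ℕ) ≠ 0) (hx : ∀ j : ℤ, ∃ r : ℕ, x (j + r) = letter a 0) :
    UniqueCut (substWord a) x := by
  intro y c y' c' h h'
  have hiff : ∀ (r : ℕ) (j : ℤ), x (j + r) = letter a 0 →
      (j + 1 ∈ Set.range c ↔ j + 1 ∈ Set.range c') := by
    intro r
    induction r with
    | zero =>
      intro j hj
      have hj' : x j = letter a 0 := by simpa using hj
      rw [h.mem_range_iff ha, h'.mem_range_iff ha]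
      simp [hj']
    | succ r ih =>
      intro j hj
      rw [h.mem_range_iff ha, h'.mem_range_iff ha]
      have := ih (j + 1) (by rw [← hj]; congr 1; push_cast; ring)
      rw [show j + 1 + 1 = j + 2 by ring] at this
      rw [this]
  have hr : Set.range c = Set.range c' := by
    ext s
    obtain ⟨r, hr⟩ := hx (s - 1)
    simpa using hiff r _ hr
  obtain ⟨t, ht⟩ := exists_translate_of_range_eq (h.strictMono (substitution a).ne_nil)
    (h'.strictMono (substitution a).ne_nil) hr
  refine ⟨t, fun i => next_injective a ?_, ht⟩
  rw [← h'.apply_eq_next, ← h.apply_eq_next, ht]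
  congr 2
  ring_nf

end Unique

theorem substitution_isRecognizable (ha : (a 0 : ℕ) ≠ 0) {C : ℕ}
    (hC : ∀ i, ∃ j ≤ C, (a (i + j) : ℕ) ≠ 0) : (substitution a).IsRecognizable := by
  have hex : ∀ x ∈ (substitution a).subshift,
      ∃ y c, y ∈ (substitution a).subshift ∧ IsCut (substitution a).toFun x y c :=
    fun x hx => (substitution a).exists_isCut_mem_subshift hx
  refine (substitution a).isRecognizable_of_uniqueCut hex fun x hx => ?_
  refine uniqueCut_substWord ha fun j => ?_
  obtain ⟨y, c, -, hc⟩ := (substitution a).exists_isCut_supertile hex (C + 1) x hx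
  have hmono := hc.strictMono ((substitution a).supertile_ne_nil _)
  obtain ⟨i, hi1, hi2⟩ := exists_mem_Ico_of_strictMono hmono j
  -- The supertile after the one covering `j` is used, so its `[0]` lies to the right of `j`.
  obtain ⟨s, hs, hs'⟩ := List.getElem_of_mem (letter_zero_mem_supertile a ha hC (y (i + 1)))
  refine ⟨(c (i + 1) + s - j).toNat, ?_⟩
  rw [show j + ((c (i + 1) + s - j).toNat : ℤ) = c (i + 1) + s by omega, ← hs']
  exact (window_eq_iff _ _ _).1 (hc (i + 1)).2 s hs

end Alphabet

/-! ## The spectral radius of the substitution operator -/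

theorem spectralRadius_smul {𝕜 E : Type*} [NormedField 𝕜] [NormedRing E] [NormedAlgebra 𝕜 E]
    {k : 𝕜} (hk : k ≠ 0) (T : E) : spectralRadius 𝕜 (k • T) = ‖k‖₊ * spectralRadius 𝕜 T := by
  have h : spectrum 𝕜 (k • T) = (fun l => k * l) '' spectrum 𝕜 T :=
    spectrum.unit_smul_eq_smul T (Units.mk0 k hk)
  simp only [spectralRadius, h, iSup_image, ENNReal.mul_iSup, nnnorm_mul, ENNReal.coe_mul]

theorem length_mul_le_sum {A : Type*} {w : List A} {u : A → ℝ} {m : ℝ} (h : ∀ b, m ≤ u b) :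
    w.length * m ≤ (w.map u).sum := by
  induction w with
  | nil => simp
  | cons b w ih =>
    have := h b
    simp only [List.length_cons, List.map_cons, List.sum_cons]
    push_cast
    linarith

theorem eventually_isUnit_and_continuousAt_inverse {𝕜 E : Type*} [RCLike 𝕜] [NormedRing E]
    [NormedAlgebra 𝕜 E] [CompleteSpace E] {T : E} {s : ℝ} (hs : (s : 𝕜) ∉ spectrum 𝕜 T) :
    (∀ᶠ l : ℝ in 𝓝 s, IsUnit (algebraMap 𝕜 E (l : 𝕜) - T)) ∧
      ContinuousAt (fun l : ℝ => Ring.inverse (algebraMap 𝕜 E (l : 𝕜) - T)) s := by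
  have hφ : Continuous fun l : ℝ => algebraMap 𝕜 E (l : 𝕜) - T :=
    ((continuous_algebraMap 𝕜 E).comp RCLike.continuous_ofReal).sub continuous_const
  obtain ⟨w, hw⟩ := spectrum.notMem_iff.1 hs
  constructor
  · exact hφ.continuousAt.preimage_mem_nhds (hw ▸ Units.nhds w)
  · have h1 : ContinuousAt Ring.inverse (algebraMap 𝕜 E (s : 𝕜) - T) :=
      hw ▸ NormedRing.inverse_continuousAt w
    exact ContinuousAt.comp (f := fun l : ℝ => algebraMap 𝕜 E (l : 𝕜) - T) h1 hφ.continuousAt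

theorem norm_sum_map_le_countOutside {A 𝕜 : Type*} [RCLike 𝕜] {F : Set A} {f : A → 𝕜} {D : ℝ} (h0 : ∀ b ∈ F, f b = 0)
    (hD : ∀ b, ‖f b‖ ≤ D) (w : List A) : ‖(w.map f).sum‖ ≤ countOutside F w * D := by
  induction w with
  | nil => simp [countOutside]
  | cons b w ih =>
    rw [show b :: w = [b] ++ w from rfl, countOutside_append, List.map_append, List.sum_append]
    refine (norm_add_le _ _).trans ?_
    push_cast
    rw [add_mul]
    refine add_le_add ?_ ih
    by_cases hb : b ∈ F
    · simp [countOutside, hb, h0 b hb]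
    · simpa [countOutside, hb] using hD b

section General

variable {A : Type*} [TopologicalSpace A] (ρ : Substitution A)

/-- `l` belongs to this set if there is a positive continuous function `u` with `M u ≤ l u`. -/
def Substitution.superSet : Set ℝ :=
  {l | 0 < l ∧ ∃ u : C(A, ℝ), (∀ b, 0 < u b) ∧ ∀ b, ((ρ.toFun b).map u).sum ≤ l * u b}

theorem Substitution.sum_supertile_le {l : ℝ} (hl : 0 ≤ l) {u : A → ℝ}
    (h : ∀ b, ((ρ.toFun b).map u).sum ≤ l * u b) (k : ℕ) (b : A) :
    ((ρ.supertile k b).map u).sum ≤ l ^ k * u b := by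
  induction k with
  | zero => simp [supertile]
  | succ k ih =>
    have h1 : ∀ w : List A, ((w.flatMap ρ.toFun).map u).sum ≤ l * (w.map u).sum := by
      intro w
      induction w with
      | nil => simp
      | cons c w ihw =>
        have := h c
        simp only [List.flatMap_cons, List.map_append, List.sum_append, List.map_cons,
          List.sum_cons]
        linarith
    rw [supertile_succ']
    refine (h1 _).trans ?_
    rw [pow_succ', mul_assoc]
    exact mul_le_mul_of_nonneg_left ih hl

theorem Substitution.bddBelow_superSet : BddBelow ρ.superSet := ⟨0, fun _ hl => hl.1.le⟩

section Compact

variable [CompactSpace A]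

theorem Substitution.superSet_nonempty : ρ.superSet.Nonempty := by
  obtain ⟨B, hB⟩ := ρ.exists_length_le
  refine ⟨B + 1, by positivity, 1, fun b => by simp, fun b => ?_⟩
  have : ((ρ.toFun b).length : ℝ) ≤ B := by exact_mod_cast hB b
  have h1 : ((ρ.toFun b).map (1 : C(A, ℝ))).sum = (ρ.toFun b).length := by
    simp [ContinuousMap.coe_one, Pi.one_def]
  rw [h1, ContinuousMap.one_apply]
  linarith

theorem Substitution.operator_pow_apply (𝕜 : Type*) [RCLike 𝕜] (k : ℕ) (f : C(A, 𝕜)) (b : A) :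
    ((ρ.operator 𝕜 ^ k) f) b = ((ρ.supertile k b).map f).sum := by
  induction k generalizing b with
  | zero => simp [supertile]
  | succ k ih =>
    have h1 : ∀ w : List A, (w.map ((ρ.operator 𝕜 ^ k) f)).sum =
        ((w.flatMap (ρ.supertile k)).map f).sum := by
      intro w
      induction w with
      | nil => simp
      | cons c w ihw =>
        simp only [List.flatMap_cons, List.map_append, List.sum_append, List.map_cons,
          List.sum_cons, ih, ihw]
    rw [pow_succ', supertile_succ, ← h1]
    rfl

variable {𝕜 : Type*} [RCLike 𝕜]

/-- The real part of a continuous function. -/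
def realPart (f : C(A, 𝕜)) : C(A, ℝ) :=
  ⟨fun b => RCLike.re (f b), RCLike.continuous_re.comp f.continuous⟩

theorem continuous_realPart_apply (b : A) :
    Continuous fun T : C(A, 𝕜) →L[𝕜] C(A, 𝕜) => realPart (T 1) b :=
  RCLike.continuous_re.comp ((ContinuousMap.evalCLM 𝕜 b).continuous.comp
    (ContinuousLinearMap.apply 𝕜 C(A, 𝕜) (1 : C(A, 𝕜))).continuous)

/-- For real `l` the operator `l - M` commutes with real parts, which reduces both scalar fields to
real-valued functions. -/
theorem Substitution.realPart_inverse_eq {l : ℝ}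
    (hl : IsUnit (algebraMap 𝕜 (C(A, 𝕜) →L[𝕜] C(A, 𝕜)) (l : 𝕜) - ρ.operator 𝕜)) (b : A) :
    l * realPart (Ring.inverse (algebraMap 𝕜 _ (l : 𝕜) - ρ.operator 𝕜) 1) b -
      ((ρ.toFun b).map
        (realPart (Ring.inverse (algebraMap 𝕜 _ (l : 𝕜) - ρ.operator 𝕜) 1))).sum = 1 := by
  set v := Ring.inverse (algebraMap 𝕜 _ (l : 𝕜) - ρ.operator 𝕜) 1
  have h1 : (algebraMap 𝕜 (C(A, 𝕜) →L[𝕜] C(A, 𝕜)) (l : 𝕜) - ρ.operator 𝕜) v = 1 :=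
    congrArg (fun T : C(A, 𝕜) →L[𝕜] C(A, 𝕜) => T 1) (Ring.mul_inverse_cancel _ hl)
  have h2 : (l : 𝕜) * v b - ((ρ.toFun b).map v).sum = 1 := by
    rw [sub_apply, ContinuousLinearMap.algebraMap_apply] at h1
    exact congrArg (fun f : C(A, 𝕜) => f b) h1
  have h4 := congrArg (RCLike.re : 𝕜 → ℝ) h2
  rw [map_sub, RCLike.re_ofReal_mul, map_list_sum, List.map_map, RCLike.one_re] at h4
  exact h4

variable [Nonempty A]

/-- At a minimum point `b` of `u`, the sum of `u` over the supertile is at least `q * u b` and at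
most `l ^ k * u b`. -/
theorem Substitution.le_pow_of_mem_superSet {l : ℝ} (hl : l ∈ ρ.superSet) {k q : ℕ}
    (h : ∀ b, q ≤ (ρ.supertile k b).length) : (q : ℝ) ≤ l ^ k := by
  obtain ⟨hl0, u, hu, hul⟩ := hl
  obtain ⟨b, -, hb⟩ := isCompact_univ.exists_isMinOn Set.univ_nonempty u.continuous.continuousOn
  have h1 := ρ.sum_supertile_le hl0.le hul k b
  have h2 := length_mul_le_sum (w := ρ.supertile k b) fun c => isMinOn_iff.1 hb c (Set.mem_univ c)
  have h3 : (q : ℝ) ≤ (ρ.supertile k b).length := by exact_mod_cast h b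
  exact le_of_mul_le_mul_right
    (((mul_le_mul_of_nonneg_right h3 (hu b).le).trans h2).trans h1) (hu b)

theorem Substitution.le_sInf_superSet_pow {k q : ℕ} (h : ∀ b, q ≤ (ρ.supertile k b).length) :
    (q : ℝ) ≤ sInf ρ.superSet ^ k := by
  have hcl : IsClosed {l : ℝ | (q : ℝ) ≤ l ^ k} :=
    isClosed_le continuous_const (continuous_pow k)
  exact closure_minimal (fun l hl => ρ.le_pow_of_mem_superSet hl h) hcl
    (csInf_mem_closure ρ.superSet_nonempty ρ.bddBelow_superSet)

theorem Substitution.one_le_sInf_superSet : 1 ≤ sInf ρ.superSet := by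
  have := ρ.le_sInf_superSet_pow (k := 1) (q := 1) fun b =>
    List.length_pos_of_ne_nil (ρ.supertile_ne_nil 1 b)
  simpa using this

/-- Minimum principle: solutions of `l w - M w = 1` are positive if `M u ≤ l' u` for some positive
function `u` and some `l' < l`. -/
theorem Substitution.one_le_mul_of_resolvent_eq {l : ℝ} (hl : sInf ρ.superSet < l) (w : C(A, ℝ))
    (hw : ∀ b, l * w b - ((ρ.toFun b).map w).sum = 1) (b : A) : 1 ≤ l * w b := by
  obtain ⟨l', ⟨hl0, u, hu, hul⟩, hl'⟩ := exists_lt_of_csInf_lt ρ.superSet_nonempty hl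
  have hcont : Continuous fun b => w b / u b :=
    w.continuous.div₀ u.continuous fun b => (hu b).ne'
  obtain ⟨p, -, hp⟩ := isCompact_univ.exists_isMinOn Set.univ_nonempty hcont.continuousOn
  -- `θ u` is the largest multiple of `u` below `w`, touching it at `p`. If `θ < 0`, the equation at
  -- `p` would give `1 ≤ θ u(p) (l - l') ≤ 0`.
  set θ := w p / u p with hθ
  have hle : ∀ c, θ * u c ≤ w c := fun c =>
    (le_div_iff₀ (hu c)).1 (isMinOn_iff.1 hp c (Set.mem_univ c))
  have hwp : w p = θ * u p := (div_mul_cancel₀ _ (hu p).ne').symm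
  have hθ0 : 0 ≤ θ := by
    by_contra! hneg
    have h1 : θ * ((ρ.toFun p).map u).sum ≤ ((ρ.toFun p).map w).sum := by
      rw [← List.sum_map_mul_left]
      exact List.sum_le_sum fun c _ => hle c
    have h2 := mul_le_mul_of_nonpos_left (hul p) hneg.le
    have h3 := hw p
    rw [hwp] at h3
    have h4 : θ * u p * (l - l') ≤ 0 :=
      mul_nonpos_of_nonpos_of_nonneg (mul_nonpos_of_nonpos_of_nonneg hneg.le (hu p).le)
        (by linarith)
    nlinarith
  have h5 : 0 ≤ ((ρ.toFun b).map w).sum := List.sum_nonneg fun x hx => by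
    obtain ⟨c, -, rfl⟩ := List.mem_map.1 hx
    exact (mul_nonneg hθ0 (hu c).le).trans (hle c)
  have := hw b
  linarith

/-- The equation `l u - M u = 1` has no positive solution `u` for `l = inf {l | ∃ u > 0, M u ≤ l u}`. -/
theorem Substitution.not_resolvent_eq_of_pos (u : C(A, ℝ)) (hpos : ∀ b, 0 < u b)
    (hu : ∀ b, sInf ρ.superSet * u b - ((ρ.toFun b).map u).sum = 1) : False := by
  have hD : ∀ b, u b ≤ ‖u‖ := fun b => (le_abs_self _).trans (u.norm_coe_le_norm b)
  have hD0 : 0 < ‖u‖ := (hpos (Classical.arbitrary A)).trans_le (hD _)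
  -- Since `1 ≥ u / ‖u‖`, the equation shows that the infimum could be lowered by `‖u‖⁻¹`.
  have hsuper : ∀ b, ((ρ.toFun b).map u).sum ≤ (sInf ρ.superSet - ‖u‖⁻¹) * u b := by
    intro b
    have h1 := hu b
    have h2 : ‖u‖⁻¹ * u b ≤ 1 := by
      rw [inv_mul_le_iff₀ hD0, mul_one]
      exact hD b
    linarith
  have hlt : 0 < sInf ρ.superSet - ‖u‖⁻¹ := by
    have b := Classical.arbitrary A
    refine pos_of_mul_pos_left (lt_of_lt_of_le ?_ (hsuper b)) (hpos b).le
    refine List.sum_pos _ (fun x hx => ?_) (by simpa using ρ.ne_nil b)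
    obtain ⟨c, -, rfl⟩ := List.mem_map.1 hx
    exact hpos c
  have h3 := csInf_le ρ.bddBelow_superSet (show sInf ρ.superSet - ‖u‖⁻¹ ∈ ρ.superSet from
    ⟨hlt, u, hpos, hsuper⟩)
  have h4 := inv_pos.2 hD0
  linarith

/-- The bound `1 ≤ l * w b` of the minimum principle does not degenerate as `l` decreases to the
infimum, so the limit is still positive. -/
theorem Substitution.realPart_inverse_pos
    (hunit : ∀ᶠ l : ℝ in 𝓝 (sInf ρ.superSet),
      IsUnit (algebraMap 𝕜 (C(A, 𝕜) →L[𝕜] C(A, 𝕜)) (l : 𝕜) - ρ.operator 𝕜))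
    (hinv : ContinuousAt (fun l : ℝ => Ring.inverse
      (algebraMap 𝕜 (C(A, 𝕜) →L[𝕜] C(A, 𝕜)) (l : 𝕜) - ρ.operator 𝕜)) (sInf ρ.superSet)) (b : A) :
    0 < realPart (Ring.inverse (algebraMap 𝕜 (C(A, 𝕜) →L[𝕜] C(A, 𝕜))
      ((sInf ρ.superSet : ℝ) : 𝕜) - ρ.operator 𝕜) 1) b := by
  have htend : Filter.Tendsto (fun l : ℝ => l * realPart (Ring.inverse
      (algebraMap 𝕜 (C(A, 𝕜) →L[𝕜] C(A, 𝕜)) (l : 𝕜) - ρ.operator 𝕜) 1) b)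
      (𝓝[>] (sInf ρ.superSet)) (𝓝 (sInf ρ.superSet * realPart (Ring.inverse
      (algebraMap 𝕜 (C(A, 𝕜) →L[𝕜] C(A, 𝕜)) ((sInf ρ.superSet : ℝ) : 𝕜) - ρ.operator 𝕜) 1) b)) :=
    (Filter.tendsto_id.mul (((continuous_realPart_apply b).tendsto _).comp
      hinv.tendsto)).mono_left nhdsWithin_le_nhds
  refine pos_of_mul_pos_right (zero_lt_one.trans_le (ge_of_tendsto htend ?_))
    (zero_le_one.trans ρ.one_le_sInf_superSet)
  filter_upwards [nhdsWithin_le_nhds hunit, self_mem_nhdsWithin] with l hl1 hl2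
  exact ρ.one_le_mul_of_resolvent_eq hl2 _ (ρ.realPart_inverse_eq hl1) b

variable (𝕜)

/-- The real number `inf {l | ∃ u > 0, M u ≤ l u}` belongs to the spectrum of the operator. -/
theorem Substitution.sInf_superSet_mem_spectrum :
    ((sInf ρ.superSet : ℝ) : 𝕜) ∈ spectrum 𝕜 (ρ.operator 𝕜) := by
  by_contra hmem
  have hinv := eventually_isUnit_and_continuousAt_inverse (𝕜 := 𝕜)
    (E := C(A, 𝕜) →L[𝕜] C(A, 𝕜)) (T := ρ.operator 𝕜) (s := sInf ρ.superSet) hmem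
  have hs := spectrum.notMem_iff.1 hmem
  exact ρ.not_resolvent_eq_of_pos _ (ρ.realPart_inverse_pos hinv.1 hinv.2)
    (ρ.realPart_inverse_eq hs)

theorem Substitution.spectralRadius_lt_top : spectralRadius 𝕜 (ρ.operator 𝕜) < ⊤ :=
  (spectrum.spectralRadius_le_nnnorm (𝕜 := 𝕜) (ρ.operator 𝕜)).trans_lt ENNReal.coe_lt_top

theorem Substitution.sInf_superSet_le_specRadius : sInf ρ.superSet ≤ ρ.specRadius 𝕜 := by
  have h1 : (‖((sInf ρ.superSet : ℝ) : 𝕜)‖₊ : ENNReal) ≤ spectralRadius 𝕜 (ρ.operator 𝕜) :=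
    le_iSup₂ (f := fun (k : 𝕜) (_ : k ∈ spectrum 𝕜 (ρ.operator 𝕜)) => (‖k‖₊ : ENNReal)) _
      (ρ.sInf_superSet_mem_spectrum 𝕜)
  have h2 := ENNReal.toReal_mono (ρ.spectralRadius_lt_top 𝕜).ne h1
  have h3 := ρ.one_le_sInf_superSet
  rwa [ENNReal.coe_toReal, coe_nnnorm, RCLike.norm_ofReal, abs_of_nonneg (by linarith)] at h2

/-- If all level-`k` supertiles have length at least `q`, then `q ≤ r(M)ᵏ`. -/
theorem Substitution.le_specRadius_pow {k q : ℕ} (h : ∀ b, q ≤ (ρ.supertile k b).length) :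
    (q : ℝ) ≤ ρ.specRadius 𝕜 ^ k :=
  (ρ.le_sInf_superSet_pow h).trans (pow_le_pow_left₀
    (zero_le_one.trans ρ.one_le_sInf_superSet) (ρ.sInf_superSet_le_specRadius 𝕜) k)

theorem Substitution.specRadius_pos : 0 < ρ.specRadius 𝕜 :=
  (zero_lt_one.trans_le ρ.one_le_sInf_superSet).trans_le (ρ.sInf_superSet_le_specRadius 𝕜)

theorem Substitution.spectralRadius_normalizedOperator :
    spectralRadius 𝕜 (ρ.normalizedOperator 𝕜) = 1 := by
  have hr := ρ.specRadius_pos 𝕜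
  have hr' : ((ρ.specRadius 𝕜 : ℝ) : 𝕜)⁻¹ ≠ 0 := inv_ne_zero (by exact_mod_cast hr.ne')
  have h1 : ((‖((ρ.specRadius 𝕜 : ℝ) : 𝕜)‖₊ : NNReal) : ENNReal) =
      spectralRadius 𝕜 (ρ.operator 𝕜) := by
    rw [← ENNReal.toReal_eq_toReal_iff' ENNReal.coe_ne_top (ρ.spectralRadius_lt_top 𝕜).ne,
      ENNReal.coe_toReal, coe_nnnorm, RCLike.norm_ofReal, abs_of_pos hr]
    rfl
  refine (spectralRadius_smul hr' (ρ.operator 𝕜)).trans ?_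
  rw [← h1, ← ENNReal.coe_mul, ← nnnorm_mul,
    inv_mul_cancel₀ (by exact_mod_cast hr.ne'), nnnorm_one, ENNReal.coe_one]

/-! ### Quasicompactness from a letter count -/

/-- The substitution operator is quasicompact if, for some `k`, the number of letters of level-`k`
supertiles outside some finite set of isolated points is bounded by a number below `r(M)ᵏ`. -/
theorem Substitution.isQuasicompact_normalizedOperator [T1Space A] {F : Set A} (hF : F.Finite)
    (hopen : ∀ x ∈ F, IsOpen {x}) {k q : ℕ} (hk : 1 ≤ k)
    (hq : ∀ b, countOutside F (ρ.supertile k b) ≤ q) (hlt : (q : ℝ) < ρ.specRadius 𝕜 ^ k) :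
    IsQuasicompact (ρ.normalizedOperator 𝕜) := by
  classical
  refine ⟨ρ.spectralRadius_normalizedOperator 𝕜, k, ?_⟩
  have hr := ρ.specRadius_pos 𝕜
  have hFo : IsOpen F := by
    rw [← Set.biUnion_of_singleton F]
    exact isOpen_biUnion hopen
  have : Finite F := hF
  have : Fintype F := Fintype.ofFinite F
  have : DiscreteTopology F := inferInstance
  let E : C(A, 𝕜) →L[𝕜] (F → 𝕜) := ContinuousLinearMap.pi fun x => ContinuousMap.evalCLM 𝕜 x.1
  -- Extension by zero is continuous because `F` is finite and open. `P` restricts to `F` and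
  -- extends back: it has finite rank, and `f - P f` only sees letters outside `F`.
  let G : (F → 𝕜) →ₗ[𝕜] C(A, 𝕜) :=
    { toFun := fun g =>
        { toFun := fun b => if h : b ∈ F then g ⟨b, h⟩ else 0
          continuous_toFun := by
            rw [continuous_iff_continuousAt]
            intro b
            by_cases hb : b ∈ F
            · have : 𝓝 b = pure b := (isOpen_singleton_iff_nhds_eq_pure b).1 (hopen b hb)
              rw [ContinuousAt, this]
              exact tendsto_pure_nhds _ _
            · refine (continuousAt_const (y := (0 : 𝕜))).congr ?_
              filter_upwards [hF.isClosed.isOpen_compl.mem_nhds hb] with c hc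
              simp [show c ∉ F from hc] }
      map_add' := fun g g' => by
        ext b
        by_cases hb : b ∈ F <;> simp [hb]
      map_smul' := fun r g => by
        ext b
        by_cases hb : b ∈ F <;> simp [hb] }
  let P : C(A, 𝕜) →L[𝕜] C(A, 𝕜) := (LinearMap.toContinuousLinearMap G).comp E
  have hP : IsCompactOperator P :=
    (isCompactOperator_of_locallyCompactSpace_dom E).clm_comp (LinearMap.toContinuousLinearMap G)
  have hPin : ∀ f, ∀ b ∈ F, P f b = f b := fun f b hb => dif_pos hb
  have hPout : ∀ f, ∀ b ∉ F, P f b = 0 := fun f b hb => dif_neg hb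
  have hnorm : ‖ρ.operator 𝕜 ^ k - (ρ.operator 𝕜 ^ k).comp P‖ ≤ q := by
    refine ContinuousLinearMap.opNorm_le_bound _ (by positivity) fun f => ?_
    refine (ContinuousMap.norm_le _ (by positivity)).2 fun b => ?_
    have h1 : (ρ.operator 𝕜 ^ k - (ρ.operator 𝕜 ^ k).comp P) f =
        (ρ.operator 𝕜 ^ k) (f - P f) := by
      rw [map_sub]
      rfl
    rw [h1, operator_pow_apply]
    refine (norm_sum_map_le_countOutside (F := F) (D := ‖f‖) (fun c hc => ?_) (fun c => ?_)
      _).trans ?_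
    · rw [ContinuousMap.sub_apply, hPin f c hc, sub_self]
    · by_cases hc : c ∈ F
      · rw [ContinuousMap.sub_apply, hPin f c hc, sub_self, norm_zero]
        positivity
      · rw [ContinuousMap.sub_apply, hPout f c hc, sub_zero]
        exact f.norm_coe_le_norm c
    · gcongr
      exact_mod_cast hq b
  refine ⟨(((ρ.specRadius 𝕜 : 𝕜)⁻¹) ^ k) • (ρ.operator 𝕜 ^ k).comp P, hk,
    (hP.clm_comp (ρ.operator 𝕜 ^ k)).smul (((ρ.specRadius 𝕜 : 𝕜)⁻¹) ^ k), ?_⟩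
  rw [normalizedOperator, smul_pow, ← smul_sub, norm_smul, norm_pow, norm_inv, RCLike.norm_ofReal,
    abs_of_pos hr, inv_pow, inv_mul_lt_iff₀ (by positivity), mul_one]
  exact hnorm.trans_lt hlt

end Compact

end General

end CompactSubstitution

end

theorem theorem3p5 (𝕜 : Type*) [RCLike 𝕜]
    (a : ℕ → ℕ) (N C : ℕ)
    (hA1 : IsGreatest (Set.range a) N)
    (hA2 : a 0 ≠ 0)
    (hC : 0 < C)
    (hA3 : ∀ i k : ℕ, (∀ j ≤ k, a (i + j) = 0) → k < C) :
    let d := CompactSubstitution.digits a N hA1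
    let ρ := CompactSubstitution.substitution d
    let F : Set (CompactSubstitution.Alphabet d) :=
      {x | ∃ i ≤ C + 1, x = CompactSubstitution.letter d i}
    ρ.IsPrimitive ∧
    ρ.IsRecognizable ∧
    CompactSubstitution.IsQuasicompact (ρ.normalizedOperator 𝕜) ∧
    F.Finite ∧ (∀ x ∈ F, IsOpen {x}) ∧
    (∀ b : CompactSubstitution.Alphabet d,
      (CompactSubstitution.countOutside F (ρ.supertile (C + 2) b) : ℝ) <
        ρ.specRadius 𝕜 ^ (C + 2)) := by
  intro d ρ F
  have h0 : (d 0 : ℕ) ≠ 0 := hA2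
  have hgap : ∀ i, ∃ j ≤ C, (d (i + j) : ℕ) ≠ 0 := by
    intro i
    by_contra! h
    exact lt_irrefl C (hA3 i C h)
  have hF : F.Finite := by
    refine ((Set.finite_Iic (C + 1)).image (CompactSubstitution.letter d)).subset ?_
    rintro x ⟨i, hi, rfl⟩
    exact ⟨i, hi, rfl⟩
  have hopen : ∀ x ∈ F, IsOpen {x} := by
    rintro x ⟨i, -, rfl⟩
    exact CompactSubstitution.isOpen_singleton_letter d i
  have : Nonempty (CompactSubstitution.Alphabet d) := ⟨CompactSubstitution.letter d 0⟩
  have hcount := CompactSubstitution.countOutside_supertile_le d (C + 1) (C + 2) le_rfl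
  -- Strictness comes from integrality: all lengths are at least `2 ^ (C + 2) + 1`, and this bound
  -- survives the passage to the infimum.
  have hlt : ((2 ^ (C + 2) : ℕ) : ℝ) < ρ.specRadius 𝕜 ^ (C + 2) := by
    refine lt_of_lt_of_le ?_ (ρ.le_specRadius_pow 𝕜 (q := 2 ^ (C + 2) + 1)
      fun b => CompactSubstitution.two_pow_lt_length_supertile d h0 hgap b)
    push_cast
    linarith
  refine ⟨CompactSubstitution.substitution_isPrimitive d h0 hgap,
    CompactSubstitution.substitution_isRecognizable d h0 hgap,
    ρ.isQuasicompact_normalizedOperator 𝕜 hF hopen (by omega) hcount hlt, hF, hopen,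
    fun b => lt_of_le_of_lt ?_ hlt⟩
  exact_mod_cast hcount b
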